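/- Let $d\ge 1$ and equip $\mathbb{R}^d$ with the Euclidean norm. Let $\mathrm{Pr}$ be a spherically symmetric probability distribution on $\mathbb{R}^d$, that is, $HX$ has the same distribution as $X\sim\mathrm{Pr}$ for every orthogonal $d\times d$ matrix $H$. Let $X_1,X_2,\ldots$ be i.i.d. with distribution $\mathrm{Pr}$, let $U_1,U_2,\ldots$ be i.i.d. uniform on the unit sphere $\mathcal{S}^{d-1}$ and independent of $(X_i)_{i\ge1}$, and put $X_i'=\|X_i\|U_i$. Let $F$ be the joint distribution of $(X_1,X_1')$ on $\mathbb{R}^d\times\mathbb{R}^d$. With $K(x,y)=\exp\{-\|x-y\|^2/(2d)\}$ put $$g\big((x_1,x_1'),(x_2,x_2')\big)=K(x_1,x_2)+K(x_1',x_2')-K(x_1,x_2')-K(x_2,x_1'),$$ and for $n\ge 2$ let $$\hat\zeta_n=\binom n2^{-1}\sum_{1\le i<j\le n} g\big((X_i,X_i'),(X_j,X_j')\big).$$ Then: (i) The kernel $g$ is first-order degenerate: $\mathbb{E}\,g\big((x,x'),(X_1,X_1')\big)=0$ for all $(x,x')\in\mathbb{R}^d\times\mathbb{R}^d$. (ii)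 The nonzero eigenvalues of the integral equation $$\mathbb{E}\big\{g\big((x,x'),(X_1,X_1')\big)\,\psi(X_1,X_1')\big\}=\lambda\,\psi(x,x')\quad\text{for }F\text{-almost every }(x,x'),\qquad \psi\in L^2(F),\ \psi\neq0,$$ repeated according to multiplicity, can be arranged into a real sequence $(\lambda_k)_{k\ge1}$, all of whose other terms (if any) are $0$. Let $(\lambda_k)_{k\ge1}$ be any such sequence and let $Z_1,Z_2,\ldots$ be i.i.d. standard normal variables. Then the series $\sum_{k=1}^\infty\lambda_k(Z_k^2-1)$ converges unconditionally with probability one, and, as $n\to\infty$ with $d$ and $\mathrm{Pr}$ fixed, $$n\hat\zeta_n\ \stackrel{D}{\longrightarrow}\ \sum_{k=1}^\infty\lambda_k\,(Z_k^2-1).$$ -/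

import Mathlib

open MeasureTheory ProbabilityTheory Filter Topology

noncomputable section

/-- The distribution `P` on `ℝᵈ` is spherically symmetric: it is invariant under every orthogonal
transformation of `ℝᵈ`. -/
def IsSphericallySymmetric {d : ℕ} (P : Measure (EuclideanSpace ℝ (Fin d))) : Prop :=
  ∀ H : EuclideanSpace ℝ (Fin d) ≃ₗᵢ[ℝ] EuclideanSpace ℝ (Fin d), P.map H = P

/-- The uniform distribution on the unit sphere of `ℝᵈ`: the surface measure, normalised to total
mass one, as a measure on `ℝᵈ`. -/
def unifSphere (d : ℕ) : Measure (EuclideanSpace ℝ (Fin d)) :=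
  (((volume : Measure (EuclideanSpace ℝ (Fin d))).toSphere Set.univ)⁻¹ •
    (volume : Measure (EuclideanSpace ℝ (Fin d))).toSphere).map Subtype.val

/-- The spherically symmetric variant `x' = ‖x‖ u` of `x`, paired with `x`. -/
def augment {d : ℕ} (x u : EuclideanSpace ℝ (Fin d)) :
    EuclideanSpace ℝ (Fin d) × EuclideanSpace ℝ (Fin d) :=
  (x, ‖x‖ • u)

/-- The joint distribution of `(X, X')`, where `X ∼ P`, `X' = ‖X‖ U` and `U` is uniform on the unit
sphere and independent of `X`. -/
def pairLaw {d : ℕ} (P : Measure (EuclideanSpace ℝ (Fin d))) :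
    Measure (EuclideanSpace ℝ (Fin d) × EuclideanSpace ℝ (Fin d)) :=
  (P.prod (unifSphere d)).map (fun z => augment z.1 z.2)

/-- The Gaussian kernel `K(x, y) = exp(-‖x - y‖² / (2d))`. -/
def gaussK {d : ℕ} (x y : EuclideanSpace ℝ (Fin d)) : ℝ :=
  Real.exp (-‖x - y‖ ^ 2 / (2 * (d : ℝ)))

/-- The symmetric kernel
`g((x₁, x₁'), (x₂, x₂')) = K(x₁, x₂) + K(x₁', x₂') - K(x₁, x₂') - K(x₂, x₁')`. -/
def gKernel {d : ℕ} (p q : EuclideanSpace ℝ (Fin d) × EuclideanSpace ℝ (Fin d)) : ℝ :=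
  gaussK p.1 q.1 + gaussK p.2 q.2 - gaussK p.1 q.2 - gaussK q.1 p.2

/-- The U-statistic with kernel `g` of the first `n` augmented observations `w 0, …, w (n - 1)`:
the average of `g (w i) (w j)` over the pairs `i < j`. -/
def zetaHat {d : ℕ} (n : ℕ)
    (w : ℕ → EuclideanSpace ℝ (Fin d) × EuclideanSpace ℝ (Fin d)) : ℝ :=
  ((n.choose 2 : ℕ) : ℝ)⁻¹ *
    ∑ i ∈ Finset.range n, ∑ j ∈ Finset.Ico (i + 1) n, gKernel (w i) (w j)

instance unifSphere_isFiniteMeasure (d : ℕ) : IsFiniteMeasure (unifSphere d) := by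
  have h : IsFiniteMeasure
      (((volume : Measure (EuclideanSpace ℝ (Fin d))).toSphere Set.univ)⁻¹ •
        (volume : Measure (EuclideanSpace ℝ (Fin d))).toSphere) := by
    refine ⟨?_⟩
    rw [Measure.smul_apply, smul_eq_mul]
    exact lt_of_le_of_lt (ENNReal.inv_mul_le_one _) ENNReal.one_lt_top
  unfold unifSphere
  infer_instance

instance pairLaw_isFiniteMeasure {d : ℕ} (P : Measure (EuclideanSpace ℝ (Fin d)))
    [IsFiniteMeasure P] : IsFiniteMeasure (pairLaw P) := by
  unfold pairLaw
  infer_instance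

theorem continuous_gKernel {d : ℕ}
    (p : EuclideanSpace ℝ (Fin d) × EuclideanSpace ℝ (Fin d)) :
    Continuous (gKernel p) := by
  unfold gKernel gaussK
  fun_prop

theorem gaussK_mem {d : ℕ} (x y : EuclideanSpace ℝ (Fin d)) :
    0 ≤ gaussK x y ∧ gaussK x y ≤ 1 := by
  refine ⟨(Real.exp_pos _).le, ?_⟩
  unfold gaussK
  rw [Real.exp_le_one_iff, neg_div]
  have : 0 ≤ ‖x - y‖ ^ 2 / (2 * (d : ℝ)) := by positivity
  linarith

theorem abs_gKernel_le {d : ℕ}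
    (p q : EuclideanSpace ℝ (Fin d) × EuclideanSpace ℝ (Fin d)) : |gKernel p q| ≤ 2 := by
  have h1 := gaussK_mem p.1 q.1
  have h2 := gaussK_mem p.2 q.2
  have h3 := gaussK_mem p.1 q.2
  have h4 := gaussK_mem q.1 p.2
  unfold gKernel
  rw [abs_le]
  constructor <;> linarith [h1.1, h1.2, h2.1, h2.2, h3.1, h3.2, h4.1, h4.2]

theorem integrable_gKernel_mul {d : ℕ}
    (F : Measure (EuclideanSpace ℝ (Fin d) × EuclideanSpace ℝ (Fin d))) [IsFiniteMeasure F]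
    (p : EuclideanSpace ℝ (Fin d) × EuclideanSpace ℝ (Fin d)) (ψ : Lp ℝ 2 F) :
    Integrable (fun q => gKernel p q * ψ q) F := by
  have hψ : Integrable (fun q => ψ q) F := (Lp.memLp ψ).integrable (by norm_num)
  refine hψ.bdd_mul (c := 2) (continuous_gKernel p).aestronglyMeasurable ?_
  exact Filter.Eventually.of_forall fun q => by
    rw [Real.norm_eq_abs]; exact abs_gKernel_le p q

/-- The space of solutions `ψ ∈ L²(F)` of the integral equation
`∫ g(p, q) ψ(q) dF(q) = c ψ(p)`, for `F`-almost every `p`: the eigenspace, for the number `c`, of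
the integral operator on `L²(F)` with kernel `g`. -/
def gEigenspace {d : ℕ}
    (F : Measure (EuclideanSpace ℝ (Fin d) × EuclideanSpace ℝ (Fin d))) [IsFiniteMeasure F]
    (c : ℝ) : Submodule ℝ (Lp ℝ 2 F) where
  carrier := {ψ | ∀ᵐ p ∂F, ∫ q, gKernel p q * ψ q ∂F = c * ψ p}
  zero_mem' := by
    have h0 := Lp.coeFn_zero ℝ 2 F
    show ∀ᵐ p ∂F, ∫ q, gKernel p q * (0 : Lp ℝ 2 F) q ∂F = c * (0 : Lp ℝ 2 F) p
    filter_upwards [h0] with p hp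
    have : ∫ q, gKernel p q * (0 : Lp ℝ 2 F) q ∂F = ∫ _q, (0 : ℝ) ∂F :=
      integral_congr_ae (h0.mono fun q hq => by
        show gKernel p q * (0 : Lp ℝ 2 F) q = 0
        rw [hq, Pi.zero_apply, mul_zero])
    rw [this, hp]
    simp
  add_mem' := by
    intro φ ψ hφ hψ
    have h0 := Lp.coeFn_add φ ψ
    show ∀ᵐ p ∂F, ∫ q, gKernel p q * (φ + ψ) q ∂F = c * (φ + ψ) p
    filter_upwards [h0, hφ, hψ] with p hp h1 h2
    have : ∫ q, gKernel p q * (φ + ψ) q ∂F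
        = ∫ q, (gKernel p q * φ q + gKernel p q * ψ q) ∂F :=
      integral_congr_ae (h0.mono fun q hq => by
        show gKernel p q * (φ + ψ) q = _
        rw [hq, Pi.add_apply, mul_add])
    rw [this, integral_add (integrable_gKernel_mul F p φ) (integrable_gKernel_mul F p ψ),
      h1, h2, hp, Pi.add_apply, mul_add]
  smul_mem' := by
    intro a ψ hψ
    have h0 := Lp.coeFn_smul a ψ
    show ∀ᵐ p ∂F, ∫ q, gKernel p q * (a • ψ) q ∂F = c * (a • ψ) p
    filter_upwards [h0, hψ] with p hp h1
    have : ∫ q, gKernel p q * (a • ψ) q ∂F = ∫ q, a * (gKernel p q * ψ q) ∂F :=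
      integral_congr_ae (h0.mono fun q hq => by
        show gKernel p q * (a • ψ) q = _
        rw [hq, Pi.smul_apply, smul_eq_mul]; ring)
    rw [this, integral_const_mul, h1, hp, Pi.smul_apply, smul_eq_mul]
    ring

/-- `lam` lists the eigenvalues of the integral operator on `L²(F)` with kernel `g`, counted with
multiplicity: each nonzero number `c` occurs in the sequence exactly as often as the dimension of
its eigenspace says. All other terms are `0` (they contribute nothing to the limiting sum, and are
needed when there are only finitely many nonzero eigenvalues). -/
def IsEigenvalueSeq {d : ℕ}
    (F : Measure (EuclideanSpace ℝ (Fin d) × EuclideanSpace ℝ (Fin d))) [IsFiniteMeasure F]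
    (lam : ℕ → ℝ) : Prop :=
  ∀ c : ℝ, c ≠ 0 → Cardinal.mk {k : ℕ // lam k = c} = Module.rank ℝ (gEigenspace F c)

end

/-! The Gaussian kernel is positive definite: `K(x, y)` is the inner product of random Fourier
features of `x` and `y` in an L² space over the standard Gaussian measure (`inner_fourierFeature`).
Hence `g(p, q) = ⟪Φ p, Φ q⟫`, where `Φ (x, x')` is the difference of the features of `x` and `x'`.
Rotation invariance makes `g` degenerate (`integral_gKernel`), which says exactly that `Φ` has mean
zero (`integral_gFeature`).

Expanding a square turns `n ζ̂ₙ` into `n/(n-1)` times `‖Sₙ‖²/n` minus the empirical mean of `‖Φ‖²`,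
where `Sₙ` is the sum of the first `n` values of `Φ` (`mul_zetaHat_eq`). By the strong law the
subtracted mean tends to `∫ ‖Φ‖² dF`. This is the trace of the covariance operator of `Φ`, hence the
sum of its eigenvalues, all nonnegative; it supplies the centring `-1` in each term of the limit and
makes the series summable.

For `‖Sₙ‖²/n`, project onto the first `K` eigenvectors of the covariance operator. The
finite-dimensional central limit theorem gives the limit `∑ k < K, λₖ Zₖ²`, and the L¹ error of the
truncation is the tail of the trace, uniformly in `n` (`integral_sq_norm_sum`,
`tendstoInDistribution_of_approx`).

Working with the covariance operator loses nothing: with `A h = ⟪Φ ·, h⟫` it is `A* A`, while the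
integral operator is `A A*`, so the nonzero eigenvalues and their multiplicities agree
(`rank_eigenspace_covOp`). -/

noncomputable section

/-! ### Eigenvalue lists of compact symmetric operators. -/

section Eigen

open Module.End

variable {H : Type} [NormedAddCommGroup H] [InnerProductSpace ℝ H]

/-- An orthonormal family in a second countable inner product space is countable. -/
theorem Orthonormal.countable_index [SecondCountableTopology H] {ι : Type*} {v : ι → H}
    (hv : Orthonormal ℝ v) : Countable ι := by
  rw [← Set.countable_univ_iff]
  refine Set.PairwiseDisjoint.countable_of_isOpen (s := fun i => Metric.ball (v i) (1 / 2)) ?_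
    (fun i _ => Metric.isOpen_ball) (fun i _ => ⟨v i, Metric.mem_ball_self (by norm_num)⟩)
  intro i _ j _ hij
  refine Metric.ball_disjoint_ball ?_
  rw [dist_eq_norm]
  -- Distinct members lie at distance `√2 > 1`, so balls of radius `1/2` about them are disjoint.
  have h : ‖v i - v j‖ ^ 2 = 2 := by
    rw [norm_sub_sq_real, hv.1 i, hv.1 j, hv.2 hij]
    norm_num
  nlinarith [norm_nonneg (v i - v j)]

variable [CompleteSpace H]

/-- The nonzero eigenvalues of a compact symmetric operator can be listed with multiplicity. -/
theorem exists_eigenvalue_seq [SecondCountableTopology H] {T : H →L[ℝ] H}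
    (hT : IsCompactOperator T) (hT' : T.IsSymmetric) :
    ∃ lam : ℕ → ℝ, ∀ c : ℝ, c ≠ 0 →
      Cardinal.mk {k : ℕ // lam k = c} = Module.rank ℝ (eigenspace T.toLinearMap c) := by
  have hfin : ∀ c : {c : ℝ // c ≠ 0}, FiniteDimensional ℝ (eigenspace T.toLinearMap c.1) :=
    fun c => T.finite_dimensional_eigenspace hT c.1 c.2
  have hort : OrthogonalFamily ℝ (fun c : {c : ℝ // c ≠ 0} => eigenspace T.toLinearMap c.1)
      (fun c => (eigenspace T.toLinearMap c.1).subtypeₗᵢ) :=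
    hT'.orthogonalFamily_eigenspaces.comp Subtype.val_injective
  let ι := Σ c : {c : ℝ // c ≠ 0}, Fin (Module.finrank ℝ (eigenspace T.toLinearMap c.1))
  have hv := hort.orthonormal_sigma_orthonormal
    (v_family := fun c => stdOrthonormalBasis ℝ (eigenspace T.toLinearMap c.1))
    (fun c => (stdOrthonormalBasis ℝ _).orthonormal)
  have hcount : Countable ι := hv.countable_index
  obtain ⟨e, he⟩ := exists_injective_nat ι
  -- Indices outside the range of `e` receive the value `0`, which no count for `c ≠ 0` sees.
  refine ⟨Function.extend e (fun i => (i.1 : ℝ)) 0, fun c hc => ?_⟩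
  have := hfin ⟨c, hc⟩
  rw [← Module.finrank_eq_rank, ← Cardinal.mk_fin]
  refine (Cardinal.mk_congr (Equiv.ofBijective
    (fun j => ⟨e ⟨⟨c, hc⟩, j⟩, by rw [he.extend_apply]⟩) ⟨?_, ?_⟩)).symm
  · intro j j' hjj
    exact eq_of_heq (Sigma.mk.inj_iff.1 (he (Subtype.ext_iff.1 hjj))).2
  · rintro ⟨k, hk⟩
    by_cases h : ∃ i, e i = k
    · obtain ⟨⟨⟨c', hc'⟩, j⟩, rfl⟩ := h
      rw [he.extend_apply] at hk
      obtain rfl : c' = c := hk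
      exact ⟨j, rfl⟩
    · rw [Function.extend_apply' _ _ _ h] at hk
      exact absurd hk.symm hc

/-- Given a list of the nonzero eigenvalues of a compact symmetric operator, there are matching
eigenvectors, orthonormal on the indices of the nonzero eigenvalues and zero elsewhere, which
exhaust the range of the operator. -/
theorem exists_eigenfamily {T : H →L[ℝ] H} (hT : IsCompactOperator T) (hT' : T.IsSymmetric)
    {lam : ℕ → ℝ} (hlam : ∀ c : ℝ, c ≠ 0 →
      Cardinal.mk {k : ℕ // lam k = c} = Module.rank ℝ (eigenspace T.toLinearMap c)) :
    ∃ f : ℕ → H, (∀ k, T (f k) = lam k • f k) ∧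
      (∀ k l, k ≠ l → inner ℝ (f k) (f l) = 0) ∧ (∀ k, lam k ≠ 0 → ‖f k‖ = 1) ∧
      (∀ k, lam k = 0 → f k = 0) ∧ ∀ h, (∀ k, inner ℝ (f k) h = 0) → T h = 0 := by
  have hb : ∀ c : ℝ, c ≠ 0 → ∃ b : {k : ℕ // lam k = c} → eigenspace T.toLinearMap c,
      Orthonormal ℝ b ∧ Submodule.span ℝ (Set.range b) = ⊤ := by
    intro c hc
    have := T.finite_dimensional_eigenspace hT c hc
    have h := hlam c hc
    rw [← Module.finrank_eq_rank, ← Cardinal.mk_fin] at h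
    obtain ⟨e⟩ := Cardinal.eq.1 h
    have : Fintype {k : ℕ // lam k = c} := Fintype.ofEquiv _ e.symm
    let b := (stdOrthonormalBasis ℝ (eigenspace T.toLinearMap c)).reindex e.symm
    exact ⟨b, b.orthonormal, by simpa using b.toBasis.span_eq⟩
  choose! b hbo hbs using hb
  let f : ℕ → H := fun k => if lam k ≠ 0 then (b (lam k) ⟨k, rfl⟩ : H) else 0
  have hf : ∀ c, c ≠ 0 → ∀ k (hk : lam k = c), f k = b c ⟨k, hk⟩ := by
    rintro c hc k rfl
    exact if_pos hc
  have hf0 : ∀ k, lam k = 0 → f k = 0 := fun k hk => if_neg (by simpa using hk)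
  have hTf : ∀ k, T (f k) = lam k • f k := by
    intro k
    by_cases hk : lam k = 0
    · simp [hf0 k hk]
    · rw [hf _ hk k rfl]
      exact mem_eigenspace_iff.1 (b (lam k) ⟨k, rfl⟩).2
  refine ⟨f, hTf, ?_, ?_, hf0, ?_⟩
  · intro k l hkl
    by_cases hk : lam k = 0
    · simp [hf0 k hk]
    by_cases hl : lam k = lam l
    · rw [hf _ hk k rfl, hf _ hk l hl.symm]
      have := (hbo _ hk).2 (i := ⟨k, rfl⟩) (j := ⟨l, hl.symm⟩) (by simpa using hkl)
      simpa using this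
    · have h : inner ℝ (T (f k)) (f l) = inner ℝ (f k) (T (f l)) := hT' (f k) (f l)
      rw [hTf, hTf, real_inner_smul_left, real_inner_smul_right] at h
      have : (lam k - lam l) * inner ℝ (f k) (f l) = 0 := by linarith
      exact (mul_eq_zero.1 this).resolve_left (sub_ne_zero.2 hl)
  · intro k hk
    rw [hf _ hk k rfl]
    exact (hbo _ hk).1 _
  · intro h hh
    -- By symmetry `T h` is orthogonal to every eigenspace: for `c ≠ 0` because `h` is orthogonal to
    -- a spanning set, for `c = 0` trivially. The spectral theorem then forces `T h = 0`.
    have hmem : T h ∈ (⨆ c, eigenspace T.toLinearMap c)ᗮ := by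
      rw [Submodule.mem_orthogonal]
      intro u hu
      induction hu using Submodule.iSup_induction' with
      | mem c v hv =>
        have hs : inner ℝ v (T h) = inner ℝ (T v) h := (hT' v h).symm
        have hv' : T v = c • v := mem_eigenspace_iff.1 hv
        rw [hs, hv', real_inner_smul_left]
        by_cases hc : c = 0
        · simp [hc]
        have hspan : (⟨v, hv⟩ : eigenspace T.toLinearMap c) ∈ Submodule.span ℝ (Set.range (b c)) := by
          rw [hbs c hc]; trivial
        have : ∀ w ∈ Submodule.span ℝ (Set.range (b c)), inner ℝ (w : H) h = 0 := by
          intro w hw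
          induction hw using Submodule.span_induction with
          | mem w hw =>
            obtain ⟨⟨k, hk⟩, rfl⟩ := hw
            rw [← hf c hc k hk]
            exact hh k
          | zero => simp
          | add x y _ _ hx hy => simp [inner_add_left, hx, hy]
          | smul a x _ hx => simp [real_inner_smul_left, hx]
        rw [this _ hspan, mul_zero]
      | zero => simp
      | add x y _ _ hx hy => simp [inner_add_left, hx, hy]
    rw [T.orthogonalComplement_iSup_eigenspaces_eq_bot hT hT'] at hmem
    simpa using hmem

end Eigen

/-! ### Covariance operators in a Hilbert space. -/

section Cov

variable {S : Type*} [MeasurableSpace S] {H : Type*} [NormedAddCommGroup H]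
  [InnerProductSpace ℝ H] [CompleteSpace H]

/-- The covariance operator `h ↦ ∫ ⟪Φ p, h⟫ Φ p dF(p)` of a Hilbert space valued function. -/
def covOp (F : Measure S) (Φ : S → H) : H →L[ℝ] H :=
  ∫ p, InnerProductSpace.rankOne ℝ (Φ p) (Φ p) ∂F

variable {F : Measure S} [IsProbabilityMeasure F] {Φ : S → H} (hΦ : StronglyMeasurable Φ)
  {M : ℝ} (hM : ∀ p, ‖Φ p‖ ≤ M)
include hΦ hM

omit [CompleteSpace H] in
theorem integrable_rankOne_self :
    Integrable (fun p => InnerProductSpace.rankOne ℝ (Φ p) (Φ p)) F := by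
  have hc : Continuous fun x : H => InnerProductSpace.rankOne ℝ x x :=
    (ContinuousLinearMap.continuous _).clm_apply continuous_id
  refine Integrable.of_bound (hc.comp_stronglyMeasurable hΦ).aestronglyMeasurable (M * M)
    (ae_of_all _ fun p => ?_)
  rw [InnerProductSpace.norm_rankOne]
  exact mul_self_le_mul_self (norm_nonneg _) (hM p)

omit [CompleteSpace H] in
theorem covOp_apply (h : H) : covOp F Φ h = ∫ p, inner ℝ (Φ p) h • Φ p ∂F := by
  rw [covOp, ContinuousLinearMap.integral_apply (integrable_rankOne_self hΦ hM)]
  simp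

theorem inner_covOp (k h : H) :
    inner ℝ k (covOp F Φ h) = ∫ p, inner ℝ (Φ p) k * inner ℝ (Φ p) h ∂F := by
  have hi : Integrable (fun p => inner ℝ (Φ p) h • Φ p) F :=
    (integrable_rankOne_self hΦ hM).apply_continuousLinearMap h
  rw [covOp_apply hΦ hM, ← integral_inner hi]
  refine integral_congr_ae (ae_of_all _ fun p => ?_)
  simp only [real_inner_smul_right, real_inner_comm]
  ring

/-- Compact operators form a closed convex set, and the covariance operator is an average of
rank-one operators. -/
theorem isCompactOperator_covOp : IsCompactOperator (covOp F Φ) := by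
  have hs : Convex ℝ {T : H →L[ℝ] H | IsCompactOperator T} :=
    (compactOperator (RingHom.id ℝ) H H).convex
  refine hs.integral_mem isClosed_setOfPred_isCompactOperator (ae_of_all _ fun p => ?_)
    (integrable_rankOne_self hΦ hM)
  show IsCompactOperator (InnerProductSpace.rankOne ℝ (Φ p) (Φ p))
  rw [InnerProductSpace.rankOne_def']
  exact (isCompactOperator_of_locallyCompactSpace_rng
    (ContinuousLinearMap.toSpanSingleton ℝ (Φ p))).comp_clm (innerSL ℝ (Φ p))

theorem isSymmetric_covOp : (covOp F Φ).IsSymmetric := by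
  intro h k
  change inner ℝ (covOp F Φ h) k = inner ℝ h (covOp F Φ k)
  rw [real_inner_comm, inner_covOp hΦ hM, inner_covOp hΦ hM]
  simp_rw [mul_comm]

end Cov

/-! ### Passing between the covariance and integral operators. -/

section Kernel

variable {d : ℕ} {F : Measure (EuclideanSpace ℝ (Fin d) × EuclideanSpace ℝ (Fin d))}
  [IsProbabilityMeasure F] {H : Type} [NormedAddCommGroup H] [InnerProductSpace ℝ H]
  [CompleteSpace H] {Φ : EuclideanSpace ℝ (Fin d) × EuclideanSpace ℝ (Fin d) → H}

/-- For a kernel `g(p, q) = ⟪Φ p, Φ q⟫`, the covariance operator of `Φ` and the integral operator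
with kernel `g` have the same nonzero eigenvalues, with the same multiplicities. -/
theorem rank_eigenspace_covOp (hΦ : StronglyMeasurable Φ) {M : ℝ} (hM : ∀ p, ‖Φ p‖ ≤ M)
    (hg : ∀ p q, inner ℝ (Φ p) (Φ q) = gKernel p q) {c : ℝ} (hc : c ≠ 0) :
    Module.rank ℝ (Module.End.eigenspace (covOp F Φ).toLinearMap c) =
      Module.rank ℝ (gEigenspace F c) := by
  have hinner : ∀ h : H, MemLp (fun p => inner ℝ (Φ p) h) 2 F := fun h =>
    MemLp.of_bound (hΦ.inner stronglyMeasurable_const).aestronglyMeasurable (M * ‖h‖)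
      (ae_of_all _ fun p => (norm_inner_le_norm _ _).trans
        (mul_le_mul_of_nonneg_right (hM p) (norm_nonneg _)))
  have hsmul : ∀ ψ : Lp ℝ 2 F, Integrable (fun q => ψ q • Φ q) F := fun ψ =>
    ((Lp.memLp ψ).integrable (by norm_num)).smul_bdd M hΦ.aestronglyMeasurable
      (ae_of_all _ hM)
  have hint : ∀ (ψ : Lp ℝ 2 F) p, ∫ q, gKernel p q * ψ q ∂F = inner ℝ (Φ p) (∫ q, ψ q • Φ q ∂F) := by
    intro ψ p
    rw [← integral_inner (hsmul ψ)]
    simp only [real_inner_smul_right, hg, mul_comm]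
  have hmem : ∀ h ∈ Module.End.eigenspace (covOp F Φ).toLinearMap c,
      (hinner h).toLp _ ∈ gEigenspace F c := by
    intro h hh
    have hh' : covOp F Φ h = c • h := Module.End.mem_eigenspace_iff.1 hh
    rw [covOp_apply hΦ hM] at hh'
    have h0 := (hinner h).coeFn_toLp
    show ∀ᵐ p ∂F, ∫ q, gKernel p q * (hinner h).toLp _ q ∂F = c * (hinner h).toLp _ p
    filter_upwards [h0] with p hp
    rw [hint, hp, ← real_inner_smul_right, ← hh']
    congr 1
    exact integral_congr_ae (h0.mono fun q hq => by simp only [hq])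
  let A : Module.End.eigenspace (covOp F Φ).toLinearMap c →ₗ[ℝ] gEigenspace F c :=
    { toFun := fun h => ⟨(hinner h).toLp _, hmem h h.2⟩
      map_add' := fun h k => by
        refine Subtype.ext ?_
        show (hinner (h + k)).toLp _ = (hinner h).toLp _ + (hinner k).toLp _
        rw [← MemLp.toLp_add]
        exact MemLp.toLp_congr _ _ (ae_of_all _ fun p => inner_add_right _ _ _)
      map_smul' := fun a h => by
        refine Subtype.ext ?_
        show (hinner (a • h)).toLp _ = a • (hinner h).toLp _
        rw [← MemLp.toLp_const_smul]
        exact MemLp.toLp_congr _ _ (ae_of_all _ fun p => real_inner_smul_right _ _ _) }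
  refine (LinearEquiv.ofBijective A ⟨?_, ?_⟩).rank_eq
  -- If `⟪Φ ·, h⟫` vanishes almost everywhere, then `c • h = covOp F Φ h = 0`, and `c ≠ 0`.
  · rw [← LinearMap.ker_eq_bot, LinearMap.ker_eq_bot']
    intro h hh
    have h1 : (hinner h).toLp _ = 0 := congrArg Subtype.val hh
    have h2 : (fun p => inner ℝ (Φ p) (h : H)) =ᵐ[F] 0 := by
      refine (hinner h).coeFn_toLp.symm.trans ?_
      rw [h1]
      exact Lp.coeFn_zero ℝ 2 F
    have h3 : covOp F Φ h = c • (h : H) := Module.End.mem_eigenspace_iff.1 h.2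
    rw [covOp_apply hΦ hM, integral_eq_zero_of_ae (h2.mono fun p hp => by simp [hp])] at h3
    exact Subtype.ext ((smul_eq_zero.1 h3.symm).resolve_left hc)
  · rintro ⟨ψ, hψ⟩
    have hψ' : ∀ᵐ p ∂F, ∫ q, gKernel p q * ψ q ∂F = c * ψ p := hψ
    -- The adjoint of `h ↦ ⟪Φ ·, h⟫` applied to `ψ`, rescaled so that the eigenvalue equation for
    -- `ψ` gives `⟪Φ ·, h⟫ = ψ`.
    let h : H := c⁻¹ • ∫ q, ψ q • Φ q ∂F
    have h1 : ∀ᵐ p ∂F, inner ℝ (Φ p) h = ψ p := by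
      filter_upwards [hψ'] with p hp
      rw [real_inner_smul_right, ← hint, hp, inv_mul_cancel_left₀ hc]
    have h2 : covOp F Φ h = c • h := by
      rw [covOp_apply hΦ hM, smul_inv_smul₀ hc]
      exact integral_congr_ae (h1.mono fun p hp => by simp only [hp])
    refine ⟨⟨h, Module.End.mem_eigenspace_iff.2 h2⟩, Subtype.ext ?_⟩
    show (hinner h).toLp _ = ψ
    exact Lp.ext ((hinner h).coeFn_toLp.trans h1)

end Kernel

/-! ### Truncated orthogonal expansions. -/

section PartialProj

variable {H : Type*} [NormedAddCommGroup H] [InnerProductSpace ℝ H]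

/-- The sum `∑ k < K, ⟪f k, x⟫ f k`. -/
def partialProj (f : ℕ → H) (K : ℕ) : H →L[ℝ] H :=
  ∑ k ∈ Finset.range K, InnerProductSpace.rankOne ℝ (f k) (f k)

theorem partialProj_apply (f : ℕ → H) (K : ℕ) (x : H) :
    partialProj f K x = ∑ k ∈ Finset.range K, inner ℝ (f k) x • f k := by
  simp [partialProj]

variable {f : ℕ → H} (hf : ∀ k l, k ≠ l → inner ℝ (f k) (f l) = 0)
  (hf1 : ∀ k, f k = 0 ∨ ‖f k‖ = 1)
include hf hf1

theorem partialProj_self {k K : ℕ} (hk : k < K) : partialProj f K (f k) = f k := by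
  rw [partialProj_apply, Finset.sum_eq_single k (fun l _ hl => by rw [hf l k hl, zero_smul])
    (fun h => absurd (Finset.mem_range.2 hk) h)]
  rcases hf1 k with h | h
  · simp [h]
  · rw [real_inner_self_eq_norm_sq, h]; simp

/-- Pythagoras. Zero vectors in the family are harmless, since they contribute nothing to either
side; they occupy the indices of zero eigenvalues. -/
theorem norm_sub_partialProj_sq (K : ℕ) (x : H) :
    ‖x - partialProj f K x‖ ^ 2 = ‖x‖ ^ 2 - ∑ k ∈ Finset.range K, inner ℝ (f k) x ^ 2 := by
  have h1 : inner ℝ x (partialProj f K x) = ∑ k ∈ Finset.range K, inner ℝ (f k) x ^ 2 := by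
    rw [partialProj_apply, inner_sum]
    refine Finset.sum_congr rfl fun k _ => ?_
    rw [real_inner_smul_right, real_inner_comm]
    ring
  have h2 : ‖partialProj f K x‖ ^ 2 = ∑ k ∈ Finset.range K, inner ℝ (f k) x ^ 2 := by
    rw [← real_inner_self_eq_norm_sq]
    nth_rw 1 [partialProj_apply]
    rw [sum_inner]
    refine Finset.sum_congr rfl fun k hk => ?_
    have h3 : inner ℝ (f k) (partialProj f K x) = inner ℝ (partialProj f K (f k)) x := by
      simp only [partialProj_apply, inner_sum, sum_inner, real_inner_smul_left,
        real_inner_smul_right]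
      exact Finset.sum_congr rfl fun l _ => by rw [real_inner_comm (f l) (f k)]; ring
    rw [real_inner_smul_left, h3, partialProj_self hf hf1 (Finset.mem_range.1 hk)]
    ring
  rw [norm_sub_sq_real, h1, h2]
  ring

theorem norm_sub_partialProj_le (K : ℕ) (x : H) : ‖x - partialProj f K x‖ ≤ ‖x‖ := by
  have h := norm_sub_partialProj_sq hf hf1 K x
  have h0 : 0 ≤ ∑ k ∈ Finset.range K, inner ℝ (f k) x ^ 2 :=
    Finset.sum_nonneg fun k _ => sq_nonneg _
  exact (sq_le_sq₀ (norm_nonneg _) (norm_nonneg _)).1 (by linarith)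

/-- Partial projections converge on the closed span of the family. -/
theorem tendsto_sub_partialProj {x : H}
    (hx : x ∈ (Submodule.span ℝ (Set.range f)).topologicalClosure) :
    Tendsto (fun K => ‖x - partialProj f K x‖) atTop (𝓝 0) := by
  have hspan : ∀ y ∈ Submodule.span ℝ (Set.range f), ∀ᶠ K in atTop, partialProj f K y = y := by
    intro y hy
    induction hy using Submodule.span_induction with
    | mem y hy =>
      obtain ⟨k, rfl⟩ := hy
      filter_upwards [eventually_gt_atTop k] with K hK using partialProj_self hf hf1 hK
    | zero => simp
    | add y z _ _ h1 h2 => filter_upwards [h1, h2] with K h1 h2; rw [map_add, h1, h2]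
    | smul a y _ h1 => filter_upwards [h1] with K h1; rw [map_smul, h1]
  rw [Metric.tendsto_atTop']
  intro ε hε
  obtain ⟨y, hy, hxy⟩ := Metric.mem_closure_iff.1 hx ε hε
  obtain ⟨N, hN⟩ := eventually_atTop.1 (hspan y hy)
  refine ⟨N, fun K hK => ?_⟩
  -- For large `K` the finite combination `y` is fixed by the projection, so only `x - y` is left,
  -- and the residual map does not increase its norm.
  have h : x - partialProj f K x = (x - y) - partialProj f K (x - y) := by
    rw [map_sub, hN K hK.le]; abel
  rw [Real.dist_0_eq_abs, abs_norm, h]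
  rw [dist_eq_norm] at hxy
  exact (norm_sub_partialProj_le hf hf1 K _).trans_lt hxy

end PartialProj

/-! ### The trace as the sum of the eigenvalues. -/

section Trace

variable {S : Type*} [MeasurableSpace S] {F : Measure S} [IsProbabilityMeasure F]
  {H : Type*} [NormedAddCommGroup H] [InnerProductSpace ℝ H] [CompleteSpace H]
  {Φ : S → H} (hΦ : StronglyMeasurable Φ) {M : ℝ} (hM : ∀ p, ‖Φ p‖ ≤ M)
  {f : ℕ → H}
include hΦ hM

omit [CompleteSpace H] in
theorem integral_sq_norm_sub_partialProj {lam : ℕ → ℝ}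
    (hf : ∀ k l, k ≠ l → inner ℝ (f k) (f l) = 0) (hf1 : ∀ k, f k = 0 ∨ ‖f k‖ = 1)
    (hlam : ∀ k, ∫ p, inner ℝ (Φ p) (f k) * inner ℝ (Φ p) (f k) ∂F = lam k) (K : ℕ) :
    ∫ p, ‖Φ p - partialProj f K (Φ p)‖ ^ 2 ∂F =
      ∫ p, ‖Φ p‖ ^ 2 ∂F - ∑ k ∈ Finset.range K, lam k := by
  have hi : ∀ k, Integrable (fun p => inner ℝ (f k) (Φ p) ^ 2) F := fun k => by
    refine Integrable.of_bound ((stronglyMeasurable_const.inner hΦ).pow 2).aestronglyMeasurable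
      ((‖f k‖ * M) ^ 2) (ae_of_all _ fun p => ?_)
    rw [norm_pow]
    gcongr
    exact (norm_inner_le_norm _ _).trans (mul_le_mul_of_nonneg_left (hM p) (norm_nonneg _))
  have hn : Integrable (fun p => ‖Φ p‖ ^ 2) F := by
    refine Integrable.of_bound (hΦ.norm.pow 2).aestronglyMeasurable (M ^ 2)
      (ae_of_all _ fun p => ?_)
    rw [norm_pow, norm_norm]
    exact pow_le_pow_left₀ (norm_nonneg _) (hM p) 2
  simp_rw [norm_sub_partialProj_sq hf hf1]
  rw [integral_sub hn (integrable_finsetSum _ fun k _ => hi k), integral_finsetSum _ fun k _ => hi k]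
  congr 1
  refine Finset.sum_congr rfl fun k _ => ?_
  rw [← hlam k]
  exact integral_congr_ae (ae_of_all _ fun p => by simp only [real_inner_comm]; ring)

/-- The sum of the eigenvalues of the covariance operator is its trace `∫ ‖Φ‖² dF`. -/
theorem tendsto_integral_sq_norm_sub_partialProj [SecondCountableTopology H]
    (hf : ∀ k l, k ≠ l → inner ℝ (f k) (f l) = 0) (hf1 : ∀ k, f k = 0 ∨ ‖f k‖ = 1)
    (hker : ∀ h, (∀ k, inner ℝ (f k) h = 0) → covOp F Φ h = 0) :
    Tendsto (fun K => ∫ p, ‖Φ p - partialProj f K (Φ p)‖ ^ 2 ∂F) atTop (𝓝 0) := by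
  let V := (Submodule.span ℝ (Set.range f)).topologicalClosure
  have : CompleteSpace V := (Submodule.isClosed_topologicalClosure _).completeSpace_coe
  -- The covariance operator kills every vector of `Vᗮ`, so `Φ` has zero second moment in each such
  -- direction. Separability of `H` allows one null set for all directions, and `Φ` lies in `V`
  -- almost surely.
  have hae : ∀ᵐ p ∂F, Vᗮ.starProjection (Φ p) = 0 := by
    refine ae_eq_zero_of_forall_inner (𝕜 := ℝ) fun h => ?_
    have hV : ∀ k, inner ℝ (f k) (Vᗮ.starProjection h) = 0 := fun k =>
      (Submodule.mem_orthogonal _ _).1 (Submodule.starProjection_apply_mem _ h) _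
        (Submodule.le_topologicalClosure _ (Submodule.subset_span ⟨k, rfl⟩))
    have h0 := inner_covOp (F := F) hΦ hM (Vᗮ.starProjection h) (Vᗮ.starProjection h)
    rw [hker _ hV, inner_zero_right] at h0
    have hi : Integrable (fun p => inner ℝ (Φ p) (Vᗮ.starProjection h) *
        inner ℝ (Φ p) (Vᗮ.starProjection h)) F := by
      have hm := (hΦ.inner (𝕜 := ℝ) (stronglyMeasurable_const (b := Vᗮ.starProjection h)))
      refine Integrable.of_bound (hm.mul hm).aestronglyMeasurable
        ((M * ‖Vᗮ.starProjection h‖) * (M * ‖Vᗮ.starProjection h‖)) (ae_of_all _ fun p => ?_)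
      rw [norm_mul]
      have := (norm_inner_le_norm (𝕜 := ℝ) (Φ p) (Vᗮ.starProjection h)).trans
        (mul_le_mul_of_nonneg_right (hM p) (norm_nonneg _))
      exact mul_self_le_mul_self (norm_nonneg _) this
    have h1 := (integral_eq_zero_iff_of_nonneg (fun p => mul_self_nonneg _) hi).1 h0.symm
    filter_upwards [h1] with p hp
    show inner ℝ h (Vᗮ.starProjection (Φ p)) = 0
    rw [← Submodule.inner_starProjection_left_eq_right Vᗮ h (Φ p), real_inner_comm]
    exact mul_self_eq_zero.1 hp
  have hmem : ∀ᵐ p ∂F, Φ p ∈ V := by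
    filter_upwards [hae] with p hp
    rw [Submodule.starProjection_apply_eq_zero_iff, Submodule.orthogonal_orthogonal] at hp
    exact hp
  have hlim : Tendsto (fun K => ∫ p, ‖Φ p - partialProj f K (Φ p)‖ ^ 2 ∂F) atTop
      (𝓝 (∫ _p, (0 : ℝ) ∂F)) := by
    refine tendsto_integral_of_dominated_convergence (fun _ => M ^ 2) (fun K => ?_)
      (integrable_const _) (fun K => ae_of_all _ fun p => ?_) ?_
    · exact ((hΦ.sub ((partialProj f K).continuous.comp_stronglyMeasurable hΦ)).norm.pow
        2).aestronglyMeasurable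
    · rw [norm_pow, norm_norm]
      exact pow_le_pow_left₀ (norm_nonneg _)
        ((norm_sub_partialProj_le hf hf1 K _).trans (hM p)) 2
    · filter_upwards [hmem] with p hp
      simpa using (tendsto_sub_partialProj hf hf1 hp).pow 2
  simpa using hlim

end Trace

/-! ### Orthogonality of independent centred vectors. -/

section SecondMoment

variable {S : Type*} [MeasurableSpace S] {F : Measure S}
  {H : Type*} [NormedAddCommGroup H] [InnerProductSpace ℝ H] [CompleteSpace H]
  {Ω : Type*} [MeasurableSpace Ω] {μ : Measure Ω} [IsProbabilityMeasure μ]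

/-- The second moment of a sum of independent, identically distributed, centred, bounded random
variables in a Hilbert space. -/
theorem integral_sq_norm_sum {Ψ : S → H} (hΨ : StronglyMeasurable Ψ) {M : ℝ}
    (hM : ∀ p, ‖Ψ p‖ ≤ M) (h0 : ∫ p, Ψ p ∂F = 0) {W : ℕ → Ω → S} (hW : ∀ i, HasLaw (W i) F μ)
    (hind : iIndepFun W μ) (n : ℕ) :
    ∫ ω, ‖∑ i ∈ Finset.range n, Ψ (W i ω)‖ ^ 2 ∂μ = n * ∫ p, ‖Ψ p‖ ^ 2 ∂F := by
  have hmeas : ∀ i, AEStronglyMeasurable (fun ω => Ψ (W i ω)) μ := fun i =>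
    hΨ.aestronglyMeasurable.comp_aemeasurable (hW i).aemeasurable
  have hi : ∀ i j, Integrable (fun ω => inner ℝ (Ψ (W i ω)) (Ψ (W j ω))) μ := fun i j =>
    Integrable.of_bound ((hmeas i).inner (hmeas j)) (M * M) (ae_of_all _ fun ω =>
      (norm_inner_le_norm _ _).trans (mul_le_mul (hM _) (hM _) (norm_nonneg _)
        ((norm_nonneg _).trans (hM (W i ω)))))
  have hlaw : ∀ i, ∫ ω, Ψ (W i ω) ∂μ = 0 := fun i => by
    rw [← h0, ← (hW i).integral_comp hΨ.aestronglyMeasurable]; rfl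
  have hcross : ∀ i j, ∫ ω, inner ℝ (Ψ (W i ω)) (Ψ (W j ω)) ∂μ =
      if i = j then ∫ p, ‖Ψ p‖ ^ 2 ∂F else 0 := by
    intro i j
    split_ifs with hij
    · subst hij
      simp_rw [real_inner_self_eq_norm_sq]
      exact (hW i).integral_comp (f := fun p => ‖Ψ p‖ ^ 2) (hΨ.norm.pow 2).aestronglyMeasurable
    · have hint : ∀ i, Integrable Ψ (μ.map (W i)) := fun i => by
        have := Measure.isProbabilityMeasure_map (hW i).aemeasurable
        exact Integrable.of_bound hΨ.aestronglyMeasurable M (ae_of_all _ hM)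
      -- By independence the cross term is the inner product of the two means, both zero.
      have := (hind.indepFun hij).integral_bilin_comp_comp (hW i).aemeasurable
        (hW j).aemeasurable (hint i) (hint j) (innerSL ℝ)
      rw [hlaw, map_zero] at this
      exact this
  simp_rw [← real_inner_self_eq_norm_sq, sum_inner, inner_sum]
  rw [integral_finsetSum _ fun i _ => integrable_finsetSum _ fun j _ => hi i j]
  simp_rw [integral_finsetSum _ fun j _ => hi _ j, hcross, real_inner_self_eq_norm_sq]
  simp +contextual [Finset.sum_ite_eq]

end SecondMoment

/-! ### The finite-dimensional central limit theorem. -/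

section CLT

variable {S : Type*} [MeasurableSpace S] {F : Measure S} [IsProbabilityMeasure F]
  {Ω : Type*} [MeasurableSpace Ω] {μ : Measure Ω} [IsProbabilityMeasure μ]
  {Ω' : Type*} [MeasurableSpace Ω'] {ν : Measure Ω'} [IsProbabilityMeasure ν]

-- The Cramér–Wold reduction of a vector characteristic function to those of real projections.
omit [IsProbabilityMeasure μ] in
theorem charFun_map_eq_charFun_map_inner {E : Type*} [NormedAddCommGroup E]
    [InnerProductSpace ℝ E] [MeasurableSpace E] [BorelSpace E] [SecondCountableTopology E]
    {Y : Ω → E} (hY : AEMeasurable Y μ) (t : E) :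
    charFun (μ.map Y) t = charFun (μ.map fun ω => inner ℝ (Y ω) t) 1 := by
  rw [charFun_apply, charFun_apply_real, integral_map hY (by fun_prop),
    integral_map (by fun_prop) (by fun_prop)]
  simp

/-- Central limit theorem in finite dimension, for uncorrelated coordinates. -/
theorem tendstoInDistribution_euclidean {K : ℕ} {ξ : ℕ → S → ℝ} (hξ : ∀ k, Measurable (ξ k))
    (hξ2 : ∀ k, MemLp (ξ k) 2 F) (hξ0 : ∀ k, ∫ p, ξ k p ∂F = 0) {lam : ℕ → ℝ}
    (hcov : ∀ k l, ∫ p, ξ k p * ξ l p ∂F = if k = l then lam k else 0)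
    {W : ℕ → Ω → S} (hW : ∀ i, HasLaw (W i) F μ) (hind : iIndepFun W μ)
    {Z : ℕ → Ω' → ℝ} (hZ : ∀ k, HasLaw (Z k) (gaussianReal 0 1) ν) (hZind : iIndepFun Z ν) :
    TendstoInDistribution
      (fun (n : ℕ) ω => WithLp.toLp 2 fun k : Fin K =>
        (√n)⁻¹ * ∑ i ∈ Finset.range n, ξ k (W i ω)) atTop
      (fun ω => WithLp.toLp 2 fun k : Fin K => √(lam k) * Z k ω) (fun _ => μ) ν := by
  have hWm : ∀ i, AEMeasurable (W i) μ := fun i => (hW i).aemeasurable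
  have hZm : ∀ k, AEMeasurable (Z k) ν := fun k => (hZ k).aemeasurable
  have hξW : ∀ k i, AEMeasurable (fun ω => ξ k (W i ω)) μ := fun k i =>
    (hξ k).comp_aemeasurable (hWm i)
  have hm1 : ∀ n : ℕ, AEMeasurable (fun ω => WithLp.toLp 2 fun k : Fin K =>
      (√n)⁻¹ * ∑ i ∈ Finset.range n, ξ k (W i ω)) μ := fun n =>
    (WithLp.measurable_toLp 2 _).comp_aemeasurable (aemeasurable_pi_lambda _ fun k => by fun_prop)
  have hm2 : AEMeasurable (fun ω => WithLp.toLp 2 fun k : Fin K => √(lam k) * Z k ω) ν :=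
    (WithLp.measurable_toLp 2 _).comp_aemeasurable (aemeasurable_pi_lambda _ fun k => by fun_prop)
  have hlam : ∀ k, 0 ≤ lam k := fun k => by
    have := hcov k k
    rw [if_pos rfl] at this
    rw [← this]
    exact integral_nonneg fun p => mul_self_nonneg _
  refine ⟨hm1, hm2, ProbabilityMeasure.tendsto_iff_tendsto_charFun.2 fun t => ?_⟩
  simp only [ProbabilityMeasure.coe_mk]
  -- The projection of the vector in direction `t`. It is centred, and as the coordinates are
  -- uncorrelated its variance is `∑ tₖ² λₖ`, the same as for `∑ tₖ √λₖ Zₖ`.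
  let η : S → ℝ := fun p => ∑ k : Fin K, t k * ξ k p
  have hη : Measurable η := by fun_prop
  have hη2 : MemLp η 2 F := memLp_finsetSum _ fun k _ => (hξ2 k).const_mul _
  have hη0 : ∫ p, η p ∂F = 0 := by
    simp only [η]
    rw [integral_finsetSum _ fun (k : Fin K) _ =>
      ((hξ2 k).const_mul (t k)).integrable (by norm_num)]
    simp [integral_const_mul, hξ0]
  have hηv : ∫ p, η p ^ 2 ∂F = ∑ k : Fin K, t k ^ 2 * lam k := by
    have hi : ∀ k l : Fin K, Integrable (fun p => (t k * ξ k p) * (t l * ξ l p)) F := fun k l =>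
      ((hξ2 k).const_mul _).integrable_mul ((hξ2 l).const_mul _)
    simp_rw [sq, η, Finset.sum_mul_sum]
    rw [integral_finsetSum _ fun k _ => integrable_finsetSum _ fun l _ => hi k l]
    refine Finset.sum_congr rfl fun k _ => ?_
    rw [integral_finsetSum _ fun l _ => hi k l]
    have : ∀ l : Fin K, ∫ p, (t k * ξ k p) * (t l * ξ l p) ∂F =
        if k = l then t k * t k * lam k else 0 := by
      intro l
      have h1 : ∀ p, (t k * ξ k p) * (t l * ξ l p) = (t k * t l) * (ξ k p * ξ l p) := by
        intro p; ring
      simp_rw [h1]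
      rw [integral_const_mul, hcov]
      by_cases h : k = l
      · simp [h]
      · simp [h, Fin.val_inj]
    simp [this]
  have hcomp : ∀ i, ∫ ω, η (W i ω) ∂μ = 0 := fun i => by
    rw [← hη0, ← (hW i).integral_comp hη.aestronglyMeasurable]; rfl
  have hident : ∀ i, IdentDistrib (fun ω => η (W i ω)) (fun ω => η (W 0 ω)) μ μ := fun i =>
    (⟨hWm i, hWm 0, (hW i).map_eq.trans (hW 0).map_eq.symm⟩ :
      IdentDistrib (W i) (W 0) μ μ).comp hη
  have hvar : Var[fun ω => η (W 0 ω); μ] = ∑ k : Fin K, t k ^ 2 * lam k := by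
    rw [variance_eq_integral (X := fun ω => η (W 0 ω)) (hη.comp_aemeasurable (hWm 0)), hcomp 0, ← hηv,
      ← (hW 0).integral_comp (hη.pow_const 2).aestronglyMeasurable]
    simp
  have hmem : MemLp (fun ω => η (W 0 ω)) 2 μ := by
    have := (hW 0).map_eq ▸ hη2
    exact this.comp_of_map (hWm 0)
  have hclt := tendstoInDistribution_inv_sqrt_mul_sum_sub (P := μ)
    (P' := gaussianReal 0 Var[fun ω => η (W 0 ω); μ].toNNReal) (Y := id)
    (X := fun i ω => η (W i ω)) HasLaw.id hmem (hind.comp (fun _ => η) fun _ => hη) hident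
  have hchar := ProbabilityMeasure.tendsto_iff_tendsto_charFun.1 hclt.tendsto 1
  simp only [ProbabilityMeasure.coe_mk, hcomp, mul_zero, sub_zero, Measure.map_id] at hchar
  have hR : charFun (ν.map fun ω => WithLp.toLp 2 fun k : Fin K => √(lam k) * Z k ω) t =
      charFun (gaussianReal 0 Var[fun ω => η (W 0 ω); μ].toNNReal) 1 := by
    rw [charFun_map_eq_charFun_map_inner hm2]
    have h1 : (fun ω => inner ℝ (WithLp.toLp 2 fun k : Fin K => √(lam k) * Z k ω) t) =
        fun ω => ∑ k : Fin K, (t k * √(lam k)) * Z k ω := by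
      ext ω
      simp [PiLp.inner_apply, mul_assoc]
    have h2 : iIndepFun (fun (k : Fin K) ω => (t k * √(lam k)) * Z k ω) ν :=
      (hZind.precomp Fin.val_injective).comp (fun k x => (t k * √(lam k)) * x)
        (fun k => by fun_prop)
    rw [h1, h2.charFun_map_fun_sum_eq_prod (fun k => by fun_prop), Finset.prod_apply,
      charFun_gaussianReal, hvar]
    simp_rw [charFun_map_mul_comp (hZm _), (hZ _).map_eq, charFun_gaussianReal]
    rw [← Complex.exp_sum]
    have h3 : ((∑ k : Fin K, t k ^ 2 * lam k).toNNReal : ℝ) = ∑ k : Fin K, t k ^ 2 * lam k :=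
      Real.coe_toNNReal _ (Finset.sum_nonneg fun k _ => mul_nonneg (sq_nonneg _) (hlam k))
    congr 1
    have h4 : (((∑ k : Fin K, t k ^ 2 * lam k).toNNReal : ℝ) : ℂ) =
      ∑ k : Fin K, (t k : ℂ) ^ 2 * ((√(lam k) : ℝ) : ℂ) ^ 2 := by
      rw [h3]
      push_cast
      refine Finset.sum_congr rfl fun k _ => ?_
      rw [← Complex.ofReal_pow (√(lam k)), Real.sq_sqrt (hlam k)]
    simp only [h4]
    push_cast
    simp [mul_pow, Finset.sum_div, Finset.sum_neg_distrib]
  rw [hR]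
  refine hchar.congr fun n => ?_
  rw [charFun_map_eq_charFun_map_inner (hm1 n)]
  congr 2
  ext ω
  simp only [PiLp.inner_apply, η]
  rw [Finset.sum_comm, Finset.mul_sum]
  refine Finset.sum_congr rfl fun k _ => ?_
  simp [Finset.mul_sum]
  refine Finset.sum_congr rfl fun i _ => ?_
  ring

end CLT

/-! ### Convergence in distribution by truncation. -/

section Approx

variable {Ω : Type*} [MeasurableSpace Ω] {μ : Measure Ω} [IsProbabilityMeasure μ]
  {Ω' : Type*} [MeasurableSpace Ω'] {ν : Measure Ω'} [IsProbabilityMeasure ν]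

omit [IsProbabilityMeasure μ] in
theorem abs_integral_map_sub_le [IsFiniteMeasure μ] {φ : ℝ → ℝ} {C : ℝ}
    (hC : ∀ x y, dist (φ x) (φ y) ≤ C) {L : NNReal} (hL : LipschitzWith L φ) {A B : Ω → ℝ}
    (hA : AEMeasurable A μ) (hB : AEMeasurable B μ)
    (hAB : Integrable (fun ω => A ω - B ω) μ) :
    |∫ x, φ x ∂(μ.map A) - ∫ x, φ x ∂(μ.map B)| ≤ L * ∫ ω, |A ω - B ω| ∂μ := by
  have hφ : Continuous φ := hL.continuous
  have hbound : ∀ x, ‖φ x‖ ≤ ‖φ 0‖ + C := fun x => by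
    have h := hC x 0
    rw [dist_eq_norm] at h
    linarith [norm_le_norm_add_norm_sub' (φ x) (φ 0)]
  have hi : ∀ A : Ω → ℝ, AEMeasurable A μ → Integrable (fun ω => φ (A ω)) μ := fun A hA =>
    Integrable.of_bound (hφ.measurable.comp_aemeasurable hA).aestronglyMeasurable
      (‖φ 0‖ + C) (ae_of_all _ fun ω => hbound _)
  rw [integral_map hA hφ.aestronglyMeasurable, integral_map hB hφ.aestronglyMeasurable,
    ← integral_sub (hi A hA) (hi B hB), ← integral_const_mul, ← Real.norm_eq_abs]
  refine (norm_integral_le_integral_norm _).trans (integral_mono ((hi A hA).sub (hi B hB)).norm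
    (hAB.abs.const_mul _) fun ω => ?_)
  have := hL.dist_le_mul (A ω) (B ω)
  rwa [dist_eq_norm, Real.dist_eq] at this

/-- Convergence in distribution passes to uniform limits in `L¹`. -/
theorem tendstoInDistribution_of_approx {X : ℕ → Ω → ℝ} {Y : ℕ → ℕ → Ω → ℝ} {V : Ω' → ℝ}
    {V' : ℕ → Ω' → ℝ} (hX : ∀ n, AEMeasurable (X n) μ) (hV : AEMeasurable V ν)
    (hYV : ∀ K, TendstoInDistribution (Y K) atTop (V' K) (fun _ => μ) ν)
    {δ : ℕ → ℝ} (hδ : Tendsto δ atTop (𝓝 0))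
    (hXY : ∀ K n, Integrable (fun ω => X n ω - Y K n ω) μ)
    (hXYδ : ∀ K, ∀ᶠ n in atTop, ∫ ω, |X n ω - Y K n ω| ∂μ ≤ δ K)
    (hVV : ∀ K, Integrable (fun ω => V ω - V' K ω) ν)
    (hVVδ : ∀ K, ∫ ω, |V ω - V' K ω| ∂ν ≤ δ K) :
    TendstoInDistribution X atTop V (fun _ => μ) ν := by
  refine ⟨hX, hV, ?_⟩
  -- Bounded Lipschitz test functions suffice, and for these an L¹ distance bounds the difference of
  -- integrals. The error splits into three parts: truncating `X`, the limit in `n` at fixed `K`,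
  -- and truncating `V`.
  refine tendsto_iff_forall_lipschitz_integral_tendsto.2 ?_
  rintro φ ⟨C, hC⟩ ⟨L, hL⟩
  rw [Metric.tendsto_atTop']
  intro ε hε
  have hδ' : Tendsto (fun K => L * δ K) atTop (𝓝 0) := by simpa using hδ.const_mul (L : ℝ)
  obtain ⟨K, hK⟩ := (hδ'.eventually_lt_const (show (0 : ℝ) < ε / 3 by positivity)).exists
  have hlim := (tendsto_iff_forall_lipschitz_integral_tendsto.1 (hYV K).tendsto) φ ⟨C, hC⟩ ⟨L, hL⟩
  obtain ⟨N, hN⟩ := eventually_atTop.1 ((Metric.tendsto_nhds.1 hlim (ε / 3) (by positivity)).and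
    (hXYδ K))
  refine ⟨N, fun n hn => ?_⟩
  obtain ⟨h2, hd⟩ := hN n hn.le
  have h1 := abs_integral_map_sub_le hC hL (hX n) ((hYV K).forall_aemeasurable n) (hXY K n)
  have h3 := abs_integral_map_sub_le hC hL hV (hYV K).aemeasurable_limit (hVV K)
  have h1' : (L : ℝ) * ∫ ω, |X n ω - Y K n ω| ∂μ ≤ L * δ K :=
    mul_le_mul_of_nonneg_left hd L.2
  have h3' : (L : ℝ) * ∫ ω, |V ω - V' K ω| ∂ν ≤ L * δ K :=
    mul_le_mul_of_nonneg_left (hVVδ K) L.2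
  simp only [ProbabilityMeasure.coe_mk] at h2 ⊢
  rw [Real.dist_eq] at h2 ⊢
  rw [abs_le] at h1 h3
  rw [abs_lt] at h2 ⊢
  constructor <;> linarith [h1.1, h1.2, h2.1, h2.2, h3.1, h3.2]

end Approx

/-! ### Weighted series of squared Gaussians. -/

section GaussianSeries

variable {Ω' : Type*} [MeasurableSpace Ω'] {ν : Measure Ω'}

/-- A series of integrable functions with summable `L¹` norms converges absolutely almost
everywhere, and its sum is integrable. -/
theorem integrable_tsum_of_summable_integral_norm {a : ℕ → Ω' → ℝ}
    (ha : ∀ k, Integrable (a k) ν) (hs : Summable fun k => ∫ ω, ‖a k ω‖ ∂ν) :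
    (∀ᵐ ω ∂ν, Summable fun k => a k ω) ∧ Integrable (fun ω => ∑' k, a k ω) ν := by
  have hfin : ∑' k, eLpNorm (a k) 1 ν ≠ ⊤ := by
    have h : ∀ k, eLpNorm (a k) 1 ν = ENNReal.ofReal (∫ ω, ‖a k ω‖ ∂ν) := fun k => by
      rw [eLpNorm_one_eq_lintegral_enorm, ofReal_integral_norm_eq_lintegral_enorm (ha k)]
    simp_rw [h]
    exact hs.tsum_ofReal_ne_top
  have hsum : ∀ᵐ ω ∂ν, Summable fun k => a k ω :=
    (summable_norm_of_tsum_eLpNorm_ne_top le_rfl (fun k => (ha k).1) hfin).mono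
      fun ω hω => hω.of_norm
  refine ⟨hsum, ⟨?_, ?_⟩⟩
  · refine (aemeasurable_of_tendsto_metrizable_ae atTop
      (f := fun K ω => ∑ k ∈ Finset.range K, a k ω)
      (fun K => Finset.aemeasurable_fun_sum _ fun k _ => (ha k).aemeasurable)
      (hsum.mono fun ω hω => hω.hasSum.tendsto_sum_nat)).aestronglyMeasurable
  · refine lt_of_le_of_lt (lintegral_mono fun ω => enorm_tsum_le_tsum_enorm) ?_
    rw [lintegral_tsum fun k => (ha k).1.enorm]
    simp_rw [← eLpNorm_one_eq_lintegral_enorm]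
    exact hfin.lt_top

variable {Z : ℕ → Ω' → ℝ} (hZ : ∀ k, HasLaw (Z k) (gaussianReal 0 1) ν)
include hZ

theorem integral_sq_of_hasLaw_gaussian (k : ℕ) :
    Integrable (fun ω => Z k ω ^ 2) ν ∧ ∫ ω, Z k ω ^ 2 ∂ν = 1 := by
  have hm : MemLp (fun x : ℝ => x) 2 (gaussianReal 0 1) := memLp_id_gaussianReal 2
  have hv : ∫ x : ℝ, x ^ 2 ∂(gaussianReal 0 1) = 1 := by
    have h := variance_fun_id_gaussianReal (μ := 0) (v := 1)
    rw [variance_eq_integral (by fun_prop), integral_id_gaussianReal] at h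
    simpa using h
  constructor
  · have h := hm.integrable_sq
    rw [← (hZ k).map_eq] at h
    exact h.comp_aemeasurable (hZ k).aemeasurable
  · rw [← hv]
    exact (hZ k).integral_comp (f := fun x : ℝ => x ^ 2) (by fun_prop)

/-- The weighted sum of squares of standard normal variables, with summable weights. -/
theorem gaussian_sq_series {lam : ℕ → ℝ} (h0 : ∀ k, 0 ≤ lam k) {τ : ℝ} (hτ : HasSum lam τ) :
    (∀ᵐ ω ∂ν, Summable fun k => lam k * Z k ω ^ 2) ∧
      Integrable (fun ω => ∑' k, lam k * Z k ω ^ 2) ν ∧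
      (∀ K, Integrable (fun ω => ∑ k ∈ Finset.range K, lam k * Z k ω ^ 2) ν) ∧
      ∀ K, ∫ ω, |∑' k, lam k * Z k ω ^ 2 - ∑ k ∈ Finset.range K, lam k * Z k ω ^ 2| ∂ν =
        τ - ∑ k ∈ Finset.range K, lam k := by
  have hi : ∀ k, Integrable (fun ω => lam k * Z k ω ^ 2) ν := fun k =>
    (integral_sq_of_hasLaw_gaussian hZ k).1.const_mul _
  have hint : ∀ k, ∫ ω, lam k * Z k ω ^ 2 ∂ν = lam k := fun k => by
    rw [integral_const_mul, (integral_sq_of_hasLaw_gaussian hZ k).2, mul_one]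
  have hnorm : ∀ k, ∫ ω, ‖lam k * Z k ω ^ 2‖ ∂ν = lam k := fun k => by
    refine (integral_congr_ae (ae_of_all _ fun ω => ?_)).trans (hint k)
    exact Real.norm_of_nonneg (mul_nonneg (h0 k) (sq_nonneg _))
  have hs : Summable fun k => ∫ ω, ‖lam k * Z k ω ^ 2‖ ∂ν := by
    simp_rw [hnorm]; exact hτ.summable
  obtain ⟨h1, h2⟩ := integrable_tsum_of_summable_integral_norm hi hs
  have hK : ∀ K, Integrable (fun ω => ∑ k ∈ Finset.range K, lam k * Z k ω ^ 2) ν := fun K =>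
    integrable_finsetSum _ fun k _ => hi k
  refine ⟨h1, h2, hK, fun K => ?_⟩
  -- The terms are nonnegative, so the L¹ distance is a difference of means and equals the tail of
  -- `∑ λₖ`.
  have h3 : ∀ᵐ ω ∂ν, |∑' k, lam k * Z k ω ^ 2 - ∑ k ∈ Finset.range K, lam k * Z k ω ^ 2| =
      ∑' k, lam k * Z k ω ^ 2 - ∑ k ∈ Finset.range K, lam k * Z k ω ^ 2 := by
    filter_upwards [h1] with ω hω
    exact abs_of_nonneg (sub_nonneg.2 (hω.sum_le_tsum _ fun k _ =>
      mul_nonneg (h0 k) (sq_nonneg _)))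
  rw [integral_congr_ae h3, integral_sub h2 (hK K), integral_finsetSum _ fun k _ => hi k]
  simp_rw [hint]
  rw [← integral_tsum_of_summable_integral_norm hi hs]
  simp_rw [hint, hτ.tsum_eq]

end GaussianSeries

/-! ### The Hilbert space limit theorem. -/

section Limit

variable {S : Type*} [MeasurableSpace S] {F : Measure S} [IsProbabilityMeasure F]
  {H : Type*} [NormedAddCommGroup H] [InnerProductSpace ℝ H] [CompleteSpace H]
  [SecondCountableTopology H]
  {Ω : Type*} [MeasurableSpace Ω] {μ : Measure Ω} [IsProbabilityMeasure μ]
  {Ω' : Type*} [MeasurableSpace Ω'] {ν : Measure Ω'} [IsProbabilityMeasure ν]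

/-- The limit law of the squared norm of the normalised sum of i.i.d. centred bounded random
variables in a Hilbert space, and of the associated degenerate U-statistic. -/
theorem tendstoInDistribution_sq_norm {Φ : S → H} (hΦ : StronglyMeasurable Φ) {M : ℝ}
    (hM : ∀ p, ‖Φ p‖ ≤ M) (h0 : ∫ p, Φ p ∂F = 0) {f : ℕ → H} {lam : ℕ → ℝ}
    (hTf : ∀ k, covOp F Φ (f k) = lam k • f k)
    (hf : ∀ k l, k ≠ l → inner ℝ (f k) (f l) = 0) (hf1 : ∀ k, lam k ≠ 0 → ‖f k‖ = 1)
    (hf0 : ∀ k, lam k = 0 → f k = 0)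
    (hker : ∀ h, (∀ k, inner ℝ (f k) h = 0) → covOp F Φ h = 0)
    {W : ℕ → Ω → S} (hW : ∀ i, HasLaw (W i) F μ) (hind : iIndepFun W μ)
    {Z : ℕ → Ω' → ℝ} (hZ : ∀ k, HasLaw (Z k) (gaussianReal 0 1) ν) (hZind : iIndepFun Z ν) :
    (∀ᵐ ω ∂ν, Summable fun k => lam k * (Z k ω ^ 2 - 1)) ∧
    TendstoInDistribution
      (fun (n : ℕ) ω => (n / (n - 1) : ℝ) * (‖∑ i ∈ Finset.range n, Φ (W i ω)‖ ^ 2 / n -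
        (∑ i ∈ Finset.range n, ‖Φ (W i ω)‖ ^ 2) / n)) atTop
      (fun ω => ∑' k, lam k * (Z k ω ^ 2 - 1)) (fun _ => μ) ν := by
  have hf1' : ∀ k, f k = 0 ∨ ‖f k‖ = 1 := fun k => by
    by_cases h : lam k = 0
    exacts [Or.inl (hf0 k h), Or.inr (hf1 k h)]
  have hΦi : Integrable Φ F := Integrable.of_bound hΦ.aestronglyMeasurable M (ae_of_all _ hM)
  have hcov : ∀ k l, ∫ p, inner ℝ (Φ p) (f k) * inner ℝ (Φ p) (f l) ∂F =
      if k = l then lam k else 0 := by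
    intro k l
    rw [← inner_covOp hΦ hM, hTf, real_inner_smul_right]
    split_ifs with h
    · subst h
      by_cases hk : lam k = 0
      · simp [hk]
      · rw [real_inner_self_eq_norm_sq, hf1 k hk]; simp
    · rw [hf k l h, mul_zero]
  have hlam : ∀ k, 0 ≤ lam k := fun k => by
    have := hcov k k
    rw [if_pos rfl] at this
    rw [← this]
    exact integral_nonneg fun p => mul_self_nonneg _
  set τ := ∫ p, ‖Φ p‖ ^ 2 ∂F with hτdef
  have hδeq := integral_sq_norm_sub_partialProj (F := F) hΦ hM hf hf1'
    (fun k => (hcov k k).trans (if_pos rfl))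
  have hδ := tendsto_integral_sq_norm_sub_partialProj (F := F) hΦ hM hf hf1' hker
  have hτ : HasSum lam τ := by
    rw [hasSum_iff_tendsto_nat_of_nonneg hlam]
    simp only [hδeq, ← hτdef] at hδ
    simpa using hδ.const_sub τ
  obtain ⟨hsum, hVi, hVKi, hVK⟩ := gaussian_sq_series hZ hlam hτ
  have hξm : ∀ k, StronglyMeasurable fun p => inner ℝ (Φ p) (f k) := fun k =>
    hΦ.inner stronglyMeasurable_const
  have hξb : ∀ k p, ‖inner ℝ (Φ p) (f k)‖ ≤ M * ‖f k‖ := fun k p =>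
    (norm_inner_le_norm _ _).trans (mul_le_mul_of_nonneg_right (hM p) (norm_nonneg _))
  have hWm : ∀ i, AEMeasurable (W i) μ := fun i => (hW i).aemeasurable
  have hSm : ∀ n, AEStronglyMeasurable (fun ω => ∑ i ∈ Finset.range n, Φ (W i ω)) μ := fun n =>
    Finset.aestronglyMeasurable_fun_sum _ fun i _ =>
      hΦ.aestronglyMeasurable.comp_aemeasurable (hWm i)
  have hSb : ∀ n ω, ‖∑ i ∈ Finset.range n, Φ (W i ω)‖ ≤ n * M := fun n ω => by
    refine (norm_sum_le _ _).trans ((Finset.sum_le_sum fun i _ => hM (W i ω)).trans ?_)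
    simp
  -- By Pythagoras the truncation error is the normalised squared norm of the sum of residuals,
  -- which are again i.i.d., bounded and centred.
  have hSP : ∀ K n ω, ‖∑ i ∈ Finset.range n, Φ (W i ω)‖ ^ 2 / n -
      ∑ k ∈ Finset.range K, ((√n)⁻¹ * ∑ i ∈ Finset.range n, inner ℝ (Φ (W i ω)) (f k)) ^ 2 =
      ‖∑ i ∈ Finset.range n, (Φ (W i ω) - partialProj f K (Φ (W i ω)))‖ ^ 2 / n := by
    intro K n ω
    rw [Finset.sum_sub_distrib, ← map_sum, norm_sub_partialProj_sq hf hf1', sub_div,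
      Finset.sum_div]
    congr 1
    refine Finset.sum_congr rfl fun k _ => ?_
    rw [mul_pow, inv_pow, Real.sq_sqrt n.cast_nonneg, ← sum_inner, real_inner_comm]
    ring
  have hPm : ∀ K, StronglyMeasurable fun p => Φ p - partialProj f K (Φ p) := fun K =>
    hΦ.sub ((partialProj f K).continuous.comp_stronglyMeasurable hΦ)
  have hPb : ∀ K p, ‖Φ p - partialProj f K (Φ p)‖ ≤ M := fun K p =>
    (norm_sub_partialProj_le hf hf1' K _).trans (hM p)
  have hP0 : ∀ K, ∫ p, (Φ p - partialProj f K (Φ p)) ∂F = 0 := fun K => by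
    rw [integral_sub hΦi ((partialProj f K).integrable_comp hΦi),
      (partialProj f K).integral_comp_comm hΦi, h0, map_zero, sub_zero]
  have hclt : TendstoInDistribution
      (fun (n : ℕ) ω => ‖∑ i ∈ Finset.range n, Φ (W i ω)‖ ^ 2 / n) atTop
      (fun ω => ∑' k, lam k * Z k ω ^ 2) (fun _ => μ) ν := by
    refine tendstoInDistribution_of_approx
      (Y := fun K n ω => ∑ k ∈ Finset.range K,
        ((√n)⁻¹ * ∑ i ∈ Finset.range n, inner ℝ (Φ (W i ω)) (f k)) ^ 2)
      (V' := fun K ω => ∑ k ∈ Finset.range K, lam k * Z k ω ^ 2)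
      (fun n => ((hSm n).norm.aemeasurable.pow_const 2).div_const _) hVi.aemeasurable
      (fun K => ?_) hδ (fun K n => ?_) (fun K => ?_) (fun K => hVi.sub (hVKi K)) (fun K => ?_)
    · have h := (tendstoInDistribution_euclidean (F := F) (μ := μ) (K := K)
        (ξ := fun k p => inner ℝ (Φ p) (f k))
        (fun k => (hξm k).measurable)
        (fun k => MemLp.of_bound (hξm k).aestronglyMeasurable _ (ae_of_all _ (hξb k)))
        (fun k => by
          simp_rw [real_inner_comm (f k)]
          rw [integral_inner hΦi, h0, inner_zero_right]) hcov hW hind hZ hZind).continuous_comp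
        (g := fun v : EuclideanSpace ℝ (Fin K) => ∑ k, v k ^ 2) (by fun_prop)
      refine h.congr (fun n => ae_of_all _ fun ω => ?_) (ae_of_all _ fun ω => ?_)
      · simp [Finset.sum_range]
      · simp [Finset.sum_range, mul_pow, Real.sq_sqrt (hlam _)]
    · simp_rw [hSP]
      refine Integrable.of_bound (C := (n * M) ^ 2 / n) ?_ (ae_of_all _ fun ω => ?_)
      · exact ((Finset.aestronglyMeasurable_fun_sum _ fun i _ =>
          (hPm K).aestronglyMeasurable.comp_aemeasurable
            (hWm i)).norm.aemeasurable.pow_const 2).div_const _ |>.aestronglyMeasurable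
      · rw [norm_div, norm_pow, norm_norm, Real.norm_natCast]
        gcongr
        refine (norm_sum_le _ _).trans ((Finset.sum_le_sum fun i _ => hPb K (W i ω)).trans ?_)
        simp
    · filter_upwards [eventually_gt_atTop 0] with n hn
      simp_rw [hSP]
      have h1 : ∀ ω, |‖∑ i ∈ Finset.range n, (Φ (W i ω) - partialProj f K (Φ (W i ω)))‖ ^ 2 / n| =
          ‖∑ i ∈ Finset.range n, (Φ (W i ω) - partialProj f K (Φ (W i ω)))‖ ^ 2 / n := fun ω =>
        abs_of_nonneg (by positivity)
      simp_rw [h1]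
      -- The factor `n` from the second moment cancels the division by `n`, leaving a bound that is
      -- free of `n`.
      rw [integral_div, integral_sq_norm_sum (hPm K) (hPb K) (hP0 K) hW hind n,
        mul_div_cancel_left₀ _ (by positivity)]
    · rw [hVK, hδeq]
  have hDm : ∀ n : ℕ, AEMeasurable (fun ω => (∑ i ∈ Finset.range n, ‖Φ (W i ω)‖ ^ 2) / n) μ :=
    fun n => (Finset.aemeasurable_fun_sum _ fun i _ =>
      ((hΦ.norm.measurable.comp_aemeasurable (hWm i)).pow_const 2)).div_const _
  have hΦ2 : Measurable fun p => ‖Φ p‖ ^ 2 := hΦ.norm.measurable.pow_const 2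
  have hlln : ∀ᵐ ω ∂μ, Tendsto (fun n : ℕ => (∑ i ∈ Finset.range n, ‖Φ (W i ω)‖ ^ 2) / n) atTop
      (𝓝 τ) := by
    have h := strong_law_ae_real (μ := μ) (fun i ω => ‖Φ (W i ω)‖ ^ 2)
      (Integrable.of_bound (hΦ2.comp_aemeasurable (hWm 0)).aestronglyMeasurable (M ^ 2)
        (ae_of_all _ fun ω => by
          rw [norm_pow, norm_norm]; exact pow_le_pow_left₀ (norm_nonneg _) (hM _) 2))
      (fun i j hij => (hind.indepFun hij).comp hΦ2 hΦ2)
      (fun i => (⟨hWm i, hWm 0, (hW i).map_eq.trans (hW 0).map_eq.symm⟩ :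
        IdentDistrib (W i) (W 0) μ μ).comp hΦ2)
    have h2 : ∫ ω, ‖Φ (W 0 ω)‖ ^ 2 ∂μ = τ :=
      (hW 0).integral_comp (f := fun p => ‖Φ p‖ ^ 2) hΦ2.aestronglyMeasurable
    rwa [h2] at h
  have hr : Tendsto (fun n : ℕ => (n / (n - 1) : ℝ)) atTop (𝓝 1) := by
    have h1 : Tendsto (fun n : ℕ => ((n : ℝ) - 1)⁻¹) atTop (𝓝 0) :=
      tendsto_inv_atTop_zero.comp
        (tendsto_atTop_add_const_right _ (-1) tendsto_natCast_atTop_atTop)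
    have h2 : Tendsto (fun n : ℕ => 1 + ((n : ℝ) - 1)⁻¹) atTop (𝓝 1) := by
      simpa using h1.const_add 1
    refine h2.congr' ?_
    filter_upwards [eventually_gt_atTop 1] with n hn
    have : (n : ℝ) - 1 ≠ 0 := by
      have : (1 : ℝ) < n := by exact_mod_cast hn
      linarith
    field_simp
    ring
  -- Slutsky: the factor `n/(n-1)` and the diagonal mean tend jointly to the constants `1` and `τ`.
  have hpair : TendstoInMeasure μ (fun (n : ℕ) ω =>
      ((n / (n - 1) : ℝ), (∑ i ∈ Finset.range n, ‖Φ (W i ω)‖ ^ 2) / n)) atTop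
      (fun _ => ((1 : ℝ), τ)) :=
    tendstoInMeasure_of_tendsto_ae
      (fun n => (aemeasurable_const.prodMk (hDm n)).aestronglyMeasurable)
      (hlln.mono fun ω hω => hr.prodMk_nhds hω)
  have hfinal := hclt.continuous_comp_prodMk_of_tendstoInMeasure_const
    (g := fun x : ℝ × (ℝ × ℝ) => x.2.1 * (x.1 - x.2.2)) (by fun_prop) hpair
    (fun n => aemeasurable_const.prodMk (hDm n))
  have hs' : ∀ ω, (Summable fun k => lam k * Z k ω ^ 2) →
      HasSum (fun k => lam k * (Z k ω ^ 2 - 1)) (∑' k, lam k * Z k ω ^ 2 - τ) := fun ω hω => by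
    simpa [mul_sub] using hω.hasSum.sub hτ
  refine ⟨hsum.mono fun ω hω => (hs' ω hω).summable,
    hfinal.congr (fun n => EventuallyEq.rfl) (hsum.mono fun ω hω => ?_)⟩
  simp only [(hs' ω hω).tsum_eq, one_mul]

end Limit

theorem integral_add_sub_sub {T : Type*} [MeasurableSpace T] {m : Measure T} {a b c e : T → ℝ}
    (ha : Integrable a m) (hb : Integrable b m) (hc : Integrable c m) (he : Integrable e m) :
    ∫ t, (a t + b t - c t - e t) ∂m =
      ∫ t, a t ∂m + ∫ t, b t ∂m - ∫ t, c t ∂m - ∫ t, e t ∂m := by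
  rw [integral_sub (f := fun t => a t + b t - c t) ((ha.add hb).sub hc) he,
    integral_sub (f := fun t => a t + b t) (ha.add hb) hc, integral_add ha hb]

/-! ### Rotation invariance and degeneracy of the kernel. -/

section Sphere

variable {d : ℕ}

theorem isProbabilityMeasure_unifSphere (hd : 1 ≤ d) : IsProbabilityMeasure (unifSphere d) := by
  have : Nonempty (Fin d) := ⟨⟨0, hd⟩⟩
  have h0 : (volume : Measure (EuclideanSpace ℝ (Fin d))).toSphere Set.univ ≠ 0 := by
    rw [Measure.measure_univ_ne_zero]
    exact Measure.toSphere_ne_zero _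
  have : IsProbabilityMeasure (((volume : Measure (EuclideanSpace ℝ (Fin d))).toSphere Set.univ)⁻¹ •
      (volume : Measure (EuclideanSpace ℝ (Fin d))).toSphere) :=
    ⟨by rw [Measure.smul_apply, smul_eq_mul, ENNReal.inv_mul_cancel h0 (measure_ne_top _ _)]⟩
  exact Measure.isProbabilityMeasure_map measurable_subtype_coe.aemeasurable

theorem norm_eq_one_of_unifSphere : ∀ᵐ u ∂(unifSphere d), ‖u‖ = 1 := by
  have hm : MeasurableSet {u : EuclideanSpace ℝ (Fin d) | ‖u‖ = 1} :=
    measurableSet_eq_fun (by fun_prop) (by fun_prop)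
  exact (ae_map_iff measurable_subtype_coe.aemeasurable hm).2 (ae_of_all _ fun u => by simp)

open scoped Pointwise in
/-- The uniform distribution on the sphere is invariant under orthogonal transformations. -/
theorem isSphericallySymmetric_unifSphere : IsSphericallySymmetric (unifSphere d) := by
  intro H
  have hmem : ∀ x : Metric.sphere (0 : EuclideanSpace ℝ (Fin d)) 1,
      H x ∈ Metric.sphere (0 : EuclideanSpace ℝ (Fin d)) 1 := fun x => by simp
  let e : Metric.sphere (0 : EuclideanSpace ℝ (Fin d)) 1 →
      Metric.sphere (0 : EuclideanSpace ℝ (Fin d)) 1 := fun x => ⟨H x, hmem x⟩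
  have he : Measurable e := (H.continuous.measurable.comp measurable_subtype_coe).subtype_mk
  have hinv : (volume : Measure (EuclideanSpace ℝ (Fin d))).toSphere.map e =
      (volume : Measure (EuclideanSpace ℝ (Fin d))).toSphere := by
    ext s hs
    -- Surface measure is a multiple of the volume of the cone over the set, and `H` preserves
    -- volume and carries cones to cones.
    rw [Measure.map_apply he hs, Measure.toSphere_apply' _ hs, Measure.toSphere_apply' _ (he hs)]
    congr 1
    rw [← (LinearIsometryEquiv.measurePreserving H).measure_preimage_emb
      H.toHomeomorph.measurableEmbedding (Set.Ioo (0 : ℝ) 1 • (Subtype.val '' s))]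
    congr 1
    ext x
    simp only [Set.mem_smul, Set.mem_image, Set.mem_preimage, Subtype.exists, exists_and_right,
      exists_eq_right]
    constructor
    · rintro ⟨r, hr, y, ⟨hy, hys⟩, rfl⟩
      exact ⟨r, hr, H y, ⟨by simpa using hy, hys⟩, by simp⟩
    · rintro ⟨r, hr, y, ⟨hy, hys⟩, hx⟩
      refine ⟨r, hr, H.symm y, ⟨by simpa using hy, ?_⟩, ?_⟩
      · simpa [e] using hys
      · rw [← map_smul, hx, H.symm_apply_apply]
  unfold unifSphere
  rw [Measure.map_map H.continuous.measurable measurable_subtype_coe]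
  have hcomp : (H ∘ Subtype.val : Metric.sphere (0 : EuclideanSpace ℝ (Fin d)) 1 → _) =
    Subtype.val ∘ e := rfl
  rw [hcomp, ← Measure.map_map measurable_subtype_coe he, Measure.map_smul, hinv]

/-- Reflect in the hyperplane orthogonal to `v - w`. -/
theorem exists_isometry_of_norm_eq {v w : EuclideanSpace ℝ (Fin d)} (h : ‖v‖ = ‖w‖) :
    ∃ H : EuclideanSpace ℝ (Fin d) ≃ₗᵢ[ℝ] EuclideanSpace ℝ (Fin d), H v = w :=
  ⟨(Submodule.span ℝ {v - w})ᗮ.reflection, Submodule.reflection_sub h⟩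

theorem integral_comp_isometry {P : Measure (EuclideanSpace ℝ (Fin d))}
    (hP : IsSphericallySymmetric P)
    (H : EuclideanSpace ℝ (Fin d) ≃ₗᵢ[ℝ] EuclideanSpace ℝ (Fin d))
    (f : EuclideanSpace ℝ (Fin d) → ℝ) : ∫ y, f (H y) ∂P = ∫ y, f y ∂P := by
  conv_rhs => rw [← hP H]
  exact (H.toHomeomorph.measurableEmbedding.integral_map f).symm

/-- The average over the sphere of a function of `⟪u, v⟫` depends on `v` through its norm only. -/
theorem integral_unifSphere_inner_congr {v w : EuclideanSpace ℝ (Fin d)} (h : ‖v‖ = ‖w‖)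
    (φ : ℝ → ℝ) :
    ∫ u, φ (inner ℝ u v) ∂(unifSphere d) = ∫ u, φ (inner ℝ u w) ∂(unifSphere d) := by
  obtain ⟨H, rfl⟩ := exists_isometry_of_norm_eq h
  rw [← integral_comp_isometry isSphericallySymmetric_unifSphere H
    (fun u => φ (inner ℝ u (H v)))]
  simp_rw [H.inner_map_map]

theorem gaussK_comm (x y : EuclideanSpace ℝ (Fin d)) : gaussK x y = gaussK y x := by
  unfold gaussK
  rw [norm_sub_rev]

theorem gaussK_map (H : EuclideanSpace ℝ (Fin d) ≃ₗᵢ[ℝ] EuclideanSpace ℝ (Fin d))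
    (x y : EuclideanSpace ℝ (Fin d)) : gaussK (H x) (H y) = gaussK x y := by
  unfold gaussK
  rw [← map_sub, H.norm_map]

theorem continuous_gaussK :
    Continuous fun z : EuclideanSpace ℝ (Fin d) × EuclideanSpace ℝ (Fin d) => gaussK z.1 z.2 := by
  unfold gaussK
  fun_prop

theorem integrable_gaussK_comp {T : Type*} [MeasurableSpace T] {m : Measure T} [IsFiniteMeasure m]
    {a b : T → EuclideanSpace ℝ (Fin d)} (ha : Measurable a) (hb : Measurable b) :
    Integrable (fun t => gaussK (a t) (b t)) m :=
  Integrable.of_bound (continuous_gaussK.measurable.comp (ha.prodMk hb)).aestronglyMeasurable 1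
    (ae_of_all _ fun t => by
      rw [Real.norm_eq_abs, abs_of_nonneg (gaussK_mem _ _).1]; exact (gaussK_mem _ _).2)

/-- For unit `u` both integrands are the same function of `⟪u, v⟫`, with `v = ‖x‖ • y` on one side
and `v = ‖y‖ • x` on the other; these vectors have equal norm. This moves the randomisation from one
argument of the kernel to the other. -/
theorem integral_gaussK_unifSphere (x y : EuclideanSpace ℝ (Fin d)) :
    ∫ u, gaussK (‖x‖ • u) y ∂(unifSphere d) = ∫ u, gaussK x (‖y‖ • u) ∂(unifSphere d) := by
  let φ : ℝ → ℝ := fun s => Real.exp (-(‖x‖ ^ 2 + ‖y‖ ^ 2 - 2 * s) / (2 * (d : ℝ)))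
  have h1 : ∫ u, gaussK (‖x‖ • u) y ∂(unifSphere d) =
      ∫ u, φ (inner ℝ u (‖x‖ • y)) ∂(unifSphere d) := by
    refine integral_congr_ae (norm_eq_one_of_unifSphere.mono fun u hu => ?_)
    simp only [gaussK, φ]
    rw [norm_sub_sq_real, norm_smul, hu, norm_norm, real_inner_smul_left, real_inner_smul_right]
    congr 3
    ring
  have h2 : ∫ u, gaussK x (‖y‖ • u) ∂(unifSphere d) =
      ∫ u, φ (inner ℝ u (‖y‖ • x)) ∂(unifSphere d) := by
    refine integral_congr_ae (norm_eq_one_of_unifSphere.mono fun u hu => ?_)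
    simp only [gaussK, φ]
    rw [norm_sub_sq_real, norm_smul, hu, norm_norm, real_inner_smul_right, real_inner_smul_right,
      real_inner_comm]
    congr 3
    ring
  rw [h1, h2]
  exact integral_unifSphere_inner_congr (by simp [norm_smul, mul_comm]) φ

variable {P : Measure (EuclideanSpace ℝ (Fin d))} [IsProbabilityMeasure P]

/-- For a spherically symmetric `X`, the variables `X` and `‖X‖ U` give the same mean to
`K(x, ·)`. -/
theorem integral_gaussK_augment (hd : 1 ≤ d) (hP : IsSphericallySymmetric P)
    (x : EuclideanSpace ℝ (Fin d)) :
    ∫ z, gaussK x (‖z.1‖ • z.2) ∂(P.prod (unifSphere d)) = ∫ y, gaussK x y ∂P := by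
  have := isProbabilityMeasure_unifSphere hd
  have h1 : ∀ᵐ u ∂(unifSphere d), ∫ y, gaussK (‖x‖ • u) y ∂P = ∫ y, gaussK x y ∂P := by
    filter_upwards [norm_eq_one_of_unifSphere] with u hu
    obtain ⟨H, hH⟩ := exists_isometry_of_norm_eq (v := ‖x‖ • u) (w := x)
      (by rw [norm_smul, hu, norm_norm, mul_one])
    rw [← integral_comp_isometry hP H (gaussK x), ← hH]
    simp_rw [gaussK_map, hH]
  calc ∫ z, gaussK x (‖z.1‖ • z.2) ∂(P.prod (unifSphere d))
      = ∫ y, ∫ u, gaussK x (‖y‖ • u) ∂(unifSphere d) ∂P :=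
        integral_prod _ (integrable_gaussK_comp (by fun_prop) (by fun_prop))
    _ = ∫ y, ∫ u, gaussK (‖x‖ • u) y ∂(unifSphere d) ∂P := by
        simp_rw [integral_gaussK_unifSphere]
    _ = ∫ u, ∫ y, gaussK (‖x‖ • u) y ∂P ∂(unifSphere d) :=
        integral_integral_swap (integrable_gaussK_comp (by fun_prop) (by fun_prop))
    _ = ∫ _u, ∫ y, gaussK x y ∂P ∂(unifSphere d) := integral_congr_ae h1
    _ = ∫ y, gaussK x y ∂P := by simp

theorem measurable_augment : Measurable
    fun z : EuclideanSpace ℝ (Fin d) × EuclideanSpace ℝ (Fin d) => augment z.1 z.2 := by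
  unfold augment
  fun_prop

theorem isProbabilityMeasure_pairLaw (hd : 1 ≤ d) : IsProbabilityMeasure (pairLaw P) := by
  have := isProbabilityMeasure_unifSphere hd
  exact Measure.isProbabilityMeasure_map measurable_augment.aemeasurable

/-- The kernel `g` is first-order degenerate. -/
theorem integral_gKernel (hd : 1 ≤ d) (hP : IsSphericallySymmetric P)
    (p : EuclideanSpace ℝ (Fin d) × EuclideanSpace ℝ (Fin d)) :
    ∫ q, gKernel p q ∂(pairLaw P) = 0 := by
  have := isProbabilityMeasure_unifSphere hd
  have hfst : ∀ x, ∫ z, gaussK x z.1 ∂(P.prod (unifSphere d)) = ∫ y, gaussK x y ∂P := fun x => by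
    rw [integral_fun_fst (gaussK x)]; simp
  unfold pairLaw
  rw [integral_map measurable_augment.aemeasurable (continuous_gKernel p).aestronglyMeasurable]
  simp only [gKernel, augment, gaussK_comm _ p.2]
  have h : ∀ (x : EuclideanSpace ℝ (Fin d))
      (b : EuclideanSpace ℝ (Fin d) × EuclideanSpace ℝ (Fin d) → EuclideanSpace ℝ (Fin d)),
      Measurable b → Integrable (fun z => gaussK x (b z)) (P.prod (unifSphere d)) :=
    fun x b hb => integrable_gaussK_comp measurable_const hb
  have i1 := fun x => h x (fun z => z.1) (by fun_prop)
  have i2 := fun x => h x (fun z => ‖z.1‖ • z.2) (by fun_prop)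
  refine (integral_add_sub_sub (i1 p.1) (i2 p.2) (i2 p.1) (i1 p.2)).trans ?_
  rw [hfst, hfst, integral_gaussK_augment hd hP, integral_gaussK_augment hd hP]
  ring

end Sphere

/-! ### Random Fourier features of the kernel. -/

section Feature

variable {d : ℕ}

theorem memLp_fourierFeature (x : EuclideanSpace ℝ (Fin d)) :
    MemLp (fun w => Complex.exp (((√d)⁻¹ * inner ℝ w x : ℝ) * Complex.I)) 2
      (stdGaussian (EuclideanSpace ℝ (Fin d))) :=
  MemLp.of_bound (by fun_prop) 1 (ae_of_all _ fun w => (Complex.norm_exp_ofReal_mul_I _).le)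

/-- The random Fourier feature of the Gaussian kernel. -/
def fourierFeature (x : EuclideanSpace ℝ (Fin d)) :
    Lp ℂ 2 (stdGaussian (EuclideanSpace ℝ (Fin d))) :=
  (memLp_fourierFeature x).toLp _

/-- The real inner product is the real part of the standard Gaussian characteristic function at `(y
- x)/√d`; the scale `1/√d` yields the `2d` in the exponent. -/
theorem inner_fourierFeature (x y : EuclideanSpace ℝ (Fin d)) :
    inner ℝ (fourierFeature x) (fourierFeature y) = gaussK x y := by
  have hre : ∀ w : EuclideanSpace ℝ (Fin d),
      inner ℝ (Complex.exp (((√d)⁻¹ * inner ℝ w x : ℝ) * Complex.I))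
        (Complex.exp (((√d)⁻¹ * inner ℝ w y : ℝ) * Complex.I)) =
      (Complex.exp ((inner ℝ w ((√d)⁻¹ • (y - x)) : ℝ) * Complex.I)).re := by
    intro w
    rw [Complex.inner, ← Complex.exp_conj, ← Complex.exp_add]
    congr 2
    rw [map_mul, Complex.conj_ofReal, Complex.conj_I, real_inner_smul_right, inner_sub_right]
    push_cast
    ring
  have hint : Integrable (fun w => Complex.exp ((inner ℝ w ((√d)⁻¹ • (y - x)) : ℝ) * Complex.I))
      (stdGaussian (EuclideanSpace ℝ (Fin d))) :=
    Integrable.of_bound (by fun_prop) 1 (ae_of_all _ fun w =>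
      (Complex.norm_exp_ofReal_mul_I _).le)
  rw [L2.inner_def]
  have h1 : ∫ w, inner ℝ (fourierFeature x w) (fourierFeature y w)
        ∂(stdGaussian (EuclideanSpace ℝ (Fin d))) =
      ∫ w, (Complex.exp ((inner ℝ w ((√d)⁻¹ • (y - x)) : ℝ) * Complex.I)).re
        ∂(stdGaussian (EuclideanSpace ℝ (Fin d))) := by
    refine integral_congr_ae ?_
    filter_upwards [(memLp_fourierFeature x).coeFn_toLp, (memLp_fourierFeature y).coeFn_toLp]
      with w hx hy
    rw [← hre, ← hx, ← hy]
    rfl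
  have h2 : ∫ w, (Complex.exp ((inner ℝ w ((√d)⁻¹ • (y - x)) : ℝ) * Complex.I)).re
        ∂(stdGaussian (EuclideanSpace ℝ (Fin d))) =
      (charFun (stdGaussian (EuclideanSpace ℝ (Fin d))) ((√d)⁻¹ • (y - x))).re := by
    rw [charFun_apply]
    exact integral_re hint
  rw [h1, h2, charFun_stdGaussian]
  have h3 : Complex.exp (-(‖(√d)⁻¹ • (y - x)‖ : ℂ) ^ 2 / 2) =
      ((Real.exp (-‖(√d)⁻¹ • (y - x)‖ ^ 2 / 2) : ℝ) : ℂ) := by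
    push_cast; rfl
  rw [h3, Complex.ofReal_re, gaussK, norm_smul, mul_pow, norm_inv, inv_pow, Real.norm_eq_abs,
    sq_abs, Real.sq_sqrt d.cast_nonneg, norm_sub_rev]
  congr 1
  rw [mul_comm (2 : ℝ), ← div_div, neg_div, neg_div, neg_div]
  ring

/-- The feature map of the kernel `g`. -/
def gFeature (p : EuclideanSpace ℝ (Fin d) × EuclideanSpace ℝ (Fin d)) :
    Lp ℂ 2 (stdGaussian (EuclideanSpace ℝ (Fin d))) :=
  fourierFeature p.1 - fourierFeature p.2

theorem inner_gFeature (p q : EuclideanSpace ℝ (Fin d) × EuclideanSpace ℝ (Fin d)) :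
    inner ℝ (gFeature p) (gFeature q) = gKernel p q := by
  simp only [gFeature, inner_sub_left, inner_sub_right, inner_fourierFeature, gKernel,
    gaussK_comm q.1]
  ring

theorem norm_gFeature_le (p : EuclideanSpace ℝ (Fin d) × EuclideanSpace ℝ (Fin d)) :
    ‖gFeature p‖ ≤ 2 := by
  have h : ‖gFeature p‖ ^ 2 ≤ 2 := by
    rw [← real_inner_self_eq_norm_sq, inner_gFeature]
    exact (le_abs_self _).trans (abs_gKernel_le p p)
  nlinarith [norm_nonneg (gFeature p)]

/-- The norm of a difference of features is expressed through the continuous kernel alone. -/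
theorem continuous_gFeature : Continuous (gFeature (d := d)) := by
  refine continuous_iff_continuousAt.2 fun p => tendsto_iff_norm_sub_tendsto_zero.2 ?_
  have hg : Continuous fun q => gKernel (d := d) q q - 2 * gKernel q p + gKernel p p := by
    unfold gKernel gaussK
    fun_prop
  have h : ∀ q, ‖gFeature q - gFeature p‖ =
      √(gKernel (d := d) q q - 2 * gKernel q p + gKernel p p) := fun q => by
    rw [← Real.sqrt_sq (norm_nonneg (gFeature q - gFeature p)), norm_sub_sq_real,
      ← real_inner_self_eq_norm_sq, ← real_inner_self_eq_norm_sq]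
    simp_rw [inner_gFeature]
  simp_rw [h]
  have := (Real.continuous_sqrt.comp hg).tendsto p
  simpa [Function.comp_def, show gKernel p p - 2 * gKernel p p + gKernel p p = 0 by ring] using this

end Feature

/-! ### Independence of the augmented observations. -/

section Pairs

variable {Ω E : Type*} [MeasurableSpace Ω] {μ : Measure Ω} [IsProbabilityMeasure μ]
  [MeasurableSpace E] {X U : ℕ → Ω → E}

/-- Pairing up two jointly independent sequences gives an independent sequence. -/
theorem iIndepFun_pairs (hX : ∀ i, AEMeasurable (X i) μ) (hU : ∀ i, AEMeasurable (U i) μ)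
    (h : iIndepFun (fun s : ℕ ⊕ ℕ => Sum.elim X U s) μ) :
    iIndepFun (fun i ω => (X i ω, U i ω)) μ := by
  let g : ℕ × Bool → ℕ ⊕ ℕ := fun p => if p.2 then Sum.inr p.1 else Sum.inl p.1
  have hg : Function.Injective g := by
    rintro ⟨i, _ | _⟩ ⟨j, _ | _⟩ hij <;> simp_all [g]
  let Y : ℕ → Bool → Ω → E := fun i b => Sum.elim X U (g (i, b))
  have hY : ∀ i b, AEMeasurable (Y i b) μ := by
    rintro i (_ | _)
    exacts [hX i, hU i]
  have hpi : ∀ i b, IsProbabilityMeasure (μ.map (Y i b)) := fun i b =>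
    Measure.isProbabilityMeasure_map (hY i b)
  have h1 : iIndepFun (fun p : ℕ × Bool => Y p.1 p.2) μ := h.precomp hg
  have h2 := h1.map_fun_eq_infinitePi_map₀' (fun p : ℕ × Bool => hY p.1 p.2)
  have hrow : ∀ i, AEMeasurable (fun ω b => Y i b ω) μ := fun i =>
    aemeasurable_pi_lambda _ fun b => hY i b
  have h3 : iIndepFun (fun i ω b => Y i b ω) μ := by
    rw [iIndepFun_iff_map_fun_eq_infinitePi_map₀' hrow]
    have h4 : (fun ω i b => Y i b ω) =
        (MeasurableEquiv.curry ℕ Bool E) ∘ fun ω (p : ℕ × Bool) => Y p.1 p.2 ω := rfl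
    have h5 : AEMeasurable (fun ω (p : ℕ × Bool) => Y p.1 p.2 ω) μ :=
      aemeasurable_pi_lambda _ fun p => hY p.1 p.2
    rw [h4, ← AEMeasurable.map_map_of_aemeasurable
      (MeasurableEquiv.curry ℕ Bool E).measurable.aemeasurable h5, h2,
      Measure.infinitePi_map_curry (fun i b => μ.map (Y i b))]
    congr 1
    ext1 i
    have h6 : iIndepFun (Y i) μ := h1.precomp (g := fun b => (i, b)) (Prod.mk_right_injective i)
    exact (h6.map_fun_eq_infinitePi_map₀' (hY i)).symm
  exact h3.comp (fun _ (y : Bool → E) => (y false, y true)) (fun _ => by fun_prop)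

end Pairs

/-! ### The U-statistic as a squared norm, and the main theorem. -/

theorem two_mul_sum_Ico_inner {H : Type*} [NormedAddCommGroup H] [InnerProductSpace ℝ H]
    (v : ℕ → H) (n : ℕ) :
    2 * ∑ i ∈ Finset.range n, ∑ j ∈ Finset.Ico (i + 1) n, inner ℝ (v i) (v j) =
      ‖∑ i ∈ Finset.range n, v i‖ ^ 2 - ∑ i ∈ Finset.range n, ‖v i‖ ^ 2 := by
  induction n with
  | zero => simp
  | succ n ih =>
    have h : ∀ i ∈ Finset.range n, ∑ j ∈ Finset.Ico (i + 1) (n + 1), inner ℝ (v i) (v j) =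
        ∑ j ∈ Finset.Ico (i + 1) n, inner ℝ (v i) (v j) + inner ℝ (v i) (v n) := fun i hi =>
      Finset.sum_Ico_succ_top (Finset.mem_range.1 hi) _
    rw [Finset.sum_range_succ, Finset.sum_congr rfl h, Finset.sum_add_distrib, Finset.Ico_self,
      Finset.sum_empty, ← sum_inner, Finset.sum_range_succ, Finset.sum_range_succ, norm_add_sq_real]
    linarith

theorem mul_zetaHat_eq {d : ℕ}
    (w : ℕ → EuclideanSpace ℝ (Fin d) × EuclideanSpace ℝ (Fin d)) (n : ℕ) :
    (n : ℝ) * zetaHat n w = (n / (n - 1) : ℝ) *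
      (‖∑ i ∈ Finset.range n, gFeature (w i)‖ ^ 2 / n -
        (∑ i ∈ Finset.range n, ‖gFeature (w i)‖ ^ 2) / n) := by
  have h := two_mul_sum_Ico_inner (fun i => gFeature (w i)) n
  simp_rw [inner_gFeature] at h
  rw [← sub_div, ← h, zetaHat, Nat.cast_choose_two]
  -- For `n = 0` and `n = 1` both sides are `0`, thanks to division by zero being zero.
  rcases n with _ | _ | n
  · simp
  · simp
  · have h1 : (n : ℝ) + 1 ≠ 0 := by positivity
    have h2 : (n : ℝ) + 1 + 1 ≠ 0 := by positivity
    push_cast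
    rw [add_sub_cancel_right]
    field_simp

/-- Degeneracy makes the mean orthogonal to every feature, hence to itself. -/
theorem integral_gFeature {d : ℕ} (hd : 1 ≤ d) {P : Measure (EuclideanSpace ℝ (Fin d))}
    [IsProbabilityMeasure P] (hP : IsSphericallySymmetric P) :
    ∫ p, gFeature p ∂(pairLaw P) = 0 := by
  have hi : Integrable gFeature (pairLaw P) :=
    Integrable.of_bound continuous_gFeature.aestronglyMeasurable 2 (ae_of_all _ norm_gFeature_le)
  have h : ∀ p, inner ℝ (gFeature p) (∫ q, gFeature q ∂(pairLaw P)) = 0 := fun p => by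
    rw [← integral_inner hi]
    simp_rw [inner_gFeature]
    exact integral_gKernel hd hP p
  rw [← inner_self_eq_zero (𝕜 := ℝ), ← integral_inner hi]
  simp_rw [real_inner_comm (gFeature _), h, integral_zero]

/-- The eigenvalues of the covariance operator of the feature map are those of the kernel `g`. -/
theorem isEigenvalueSeq_iff {d : ℕ}
    (F : Measure (EuclideanSpace ℝ (Fin d) × EuclideanSpace ℝ (Fin d)))
    [IsProbabilityMeasure F] (lam : ℕ → ℝ) :
    IsEigenvalueSeq F lam ↔ ∀ c : ℝ, c ≠ 0 → Cardinal.mk {k : ℕ // lam k = c} =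
      Module.rank ℝ (Module.End.eigenspace (covOp F gFeature).toLinearMap c) :=
  forall₂_congr fun _ hc => by
    rw [rank_eigenspace_covOp (continuous_gFeature (d := d)).stronglyMeasurable norm_gFeature_le
      inner_gFeature hc]

end

theorem theorem3 {d : ℕ} (hd : 1 ≤ d)
    (P : Measure (EuclideanSpace ℝ (Fin d))) [IsProbabilityMeasure P]
    (hP : IsSphericallySymmetric P)
    {Ω : Type*} [MeasurableSpace Ω] (μ : Measure Ω) [IsProbabilityMeasure μ]
    (X U : ℕ → Ω → EuclideanSpace ℝ (Fin d))
    (hX : ∀ i, HasLaw (X i) P μ)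
    (hU : ∀ i, HasLaw (U i) (unifSphere d) μ)
    (hXU : iIndepFun (fun s : ℕ ⊕ ℕ => Sum.elim X U s) μ)
    {Ω' : Type*} [MeasurableSpace Ω'] (ν : Measure Ω') [IsProbabilityMeasure ν]
    (Z : ℕ → Ω' → ℝ)
    (hZ : ∀ k, HasLaw (Z k) (gaussianReal 0 1) ν)
    (hZind : iIndepFun Z ν) :
    (∀ p : EuclideanSpace ℝ (Fin d) × EuclideanSpace ℝ (Fin d),
      ∫ q, gKernel p q ∂(pairLaw P) = 0) ∧
    (∃ lam : ℕ → ℝ, IsEigenvalueSeq (pairLaw P) lam) ∧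
    ∀ lam : ℕ → ℝ, IsEigenvalueSeq (pairLaw P) lam →
      (∀ᵐ ω ∂ν, Summable (fun k => lam k * ((Z k ω) ^ 2 - 1))) ∧
      TendstoInDistribution
        (fun (n : ℕ) (ω : Ω) => (n : ℝ) * zetaHat n (fun i => augment (X i ω) (U i ω)))
        atTop
        (fun ω => ∑' k, lam k * ((Z k ω) ^ 2 - 1))
        (fun _ => μ) ν := by
  have := isProbabilityMeasure_pairLaw (P := P) hd
  -- Lets instance search find that the feature space L² is second countable.
  have : Fact ((2 : ENNReal) ≠ ⊤) := ⟨by simp⟩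
  have hΦ := (continuous_gFeature (d := d)).stronglyMeasurable
  have hcomp := isCompactOperator_covOp (F := pairLaw P) hΦ norm_gFeature_le
  have hsymm := isSymmetric_covOp (F := pairLaw P) hΦ norm_gFeature_le
  refine ⟨integral_gKernel hd hP, ?_, fun lam hlam => ?_⟩
  · simp_rw [isEigenvalueSeq_iff]
    exact exists_eigenvalue_seq hcomp hsymm
  · rw [isEigenvalueSeq_iff] at hlam
    obtain ⟨f, hTf, hf, hf1, hf0, hker⟩ := exists_eigenfamily hcomp hsymm hlam
    have hW : ∀ i, HasLaw (fun ω => augment (X i ω) (U i ω)) (pairLaw P) μ := fun i =>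
      HasLaw.comp ⟨measurable_augment.aemeasurable, rfl⟩ 
        (IndepFun.hasLaw_prod (hX i) (hU i)
          (hXU.indepFun (i := Sum.inl i) (j := Sum.inr i) (by simp)))
    have hind : iIndepFun (fun i ω => augment (X i ω) (U i ω)) μ :=
      (iIndepFun_pairs (fun i => (hX i).aemeasurable) (fun i => (hU i).aemeasurable) hXU).comp
        (fun _ z => augment z.1 z.2) (fun _ => measurable_augment)
    simp_rw [mul_zetaHat_eq]
    exact tendstoInDistribution_sq_norm hΦ norm_gFeature_le (integral_gFeature hd hP) hTf hf hf1
      hf0 hker hW hind hZ hZind
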